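/- Let $M$ be a smooth ($C^\infty$, Hausdorff) manifold of dimension $m$, let $\mathcal V$ be a smooth distribution on $M$ of constant dimension $n$, and let $F$ be a smooth vector field on $M$. Write $V\in\mathcal V$ for a smooth vector field $V$ on $M$ with values in $\mathcal V$, and let $\mathcal W=\mathcal V+[F,\mathcal V]$ be the collection of all vector fields $V_1+[F,V_2]$ with $V_1,V_2\in\mathcal V$. For $z\in M$ let $\mathcal W_z\subset T_zM$ be the span of the values at $z$ of the elements of $\mathcal W$, and assume that $\dim\mathcal W_z=2n$ for all $z\in M$. Assume that $\mathcal V$ and $\mathcal W$ are both involutive, i.e. closed under the Lie bracket. (1) Suppose that $F\in\mathcal W$ and that the set $\{z\in M: F(z)\in\mathcal V_z\}$ is nonempty. Then around every point of $M$ there are smooth local coordinates $(t^p,x^i,y^i)$, $p=1,\dots,m-2n$, $i=1,\dots,n$, such that $\mathcal V$ is spanned by the $\partial/\partial y^i$, $\mathcal W$ is spanned by the $\partial/\partial x^i$ and $\partial/\partial y^i$, and $$F=y^i\frac{\partial}{\partial x^i}+F^i(t,x,y)\frac{\partial}{\partial y^i}$$ for some smooth functions $F^i$; that is, $F$ has the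 form of a second-order differential equation field in $(x^i,y^i)$ with the $t^p$ as parameters. (2) Suppose that $F(z)\notin\mathcal W_z$ for every $z\in M$ and that $[F,\mathcal W]\subset\mathcal W$. Then around every point of $M$ one has $m>2n$ and there are smooth local coordinates $(t^p,x^i,y^i)$, $p=1,\dots,m-2n$, $i=1,\dots,n$, such that $\mathcal V$ is spanned by the $\partial/\partial y^i$, $\mathcal W$ is spanned by the $\partial/\partial x^i$ and $\partial/\partial y^i$, and $$F=\frac{\partial}{\partial t^1}+y^i\frac{\partial}{\partial x^i}+F^i(t,x,y)\frac{\partial}{\partial y^i}$$ for some smooth functions $F^i$; that is, $F$ has the form of a time-dependent second-order differential equation field in $(t^1,x^i,y^i)$ with the $t^p$, $p>1$, as parameters. -/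

import Mathlib

open scoped Manifold ContDiff
open Module

/-- Vector fields (not necessarily smooth) on an `m`-dimensional manifold `M`. -/
abbrev VectField (m : ℕ) (M : Type*) [TopologicalSpace M]
    [ChartedSpace (EuclideanSpace ℝ (Fin m)) M] : Type _ :=
  (z : M) → TangentSpace 𝓘(ℝ, EuclideanSpace ℝ (Fin m)) z

/-- Fields of tangent subspaces. -/
abbrev SubspaceField (m : ℕ) (M : Type*) [TopologicalSpace M]
    [ChartedSpace (EuclideanSpace ℝ (Fin m)) M] : Type _ :=
  (z : M) → Submodule ℝ (TangentSpace 𝓘(ℝ, EuclideanSpace ℝ (Fin m)) z)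

section

variable {m : ℕ} {M : Type*} [TopologicalSpace M] [ChartedSpace (EuclideanSpace ℝ (Fin m)) M]

/-- The vector field `X` is smooth on the set `U`. -/
def SmoothFieldOn [IsManifold 𝓘(ℝ, EuclideanSpace ℝ (Fin m)) ∞ M]
    (X : VectField m M) (U : Set M) : Prop :=
  ContMDiffOn 𝓘(ℝ, EuclideanSpace ℝ (Fin m)) 𝓘(ℝ, EuclideanSpace ℝ (Fin m)).tangent ∞
    (fun z => (⟨z, X z⟩ : TangentBundle 𝓘(ℝ, EuclideanSpace ℝ (Fin m)) M)) U

/-- The vector field `X` is smooth on the whole manifold. -/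
def SmoothField [IsManifold 𝓘(ℝ, EuclideanSpace ℝ (Fin m)) ∞ M] (X : VectField m M) : Prop :=
  SmoothFieldOn X Set.univ

/-- The Lie bracket `[X, Y]` of vector fields. -/
noncomputable def bracket (X Y : VectField m M) : VectField m M :=
  VectorField.mlieBracket 𝓘(ℝ, EuclideanSpace ℝ (Fin m)) X Y

/-- `V` is a smooth distribution of dimension `n`: around every point it has a local basis
consisting of `n` smooth vector fields. -/
def IsDistribution [IsManifold 𝓘(ℝ, EuclideanSpace ℝ (Fin m)) ∞ M]
    (V : SubspaceField m M) (n : ℕ) : Prop :=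
  ∀ z : M, ∃ U : Set M, IsOpen U ∧ z ∈ U ∧ ∃ X : Fin n → VectField m M,
    (∀ i, SmoothFieldOn (X i) U) ∧
    ∀ w ∈ U, LinearIndependent ℝ (fun i => X i w) ∧
      Submodule.span ℝ (Set.range fun i => X i w) = V w

/-- The vector fields belonging to a distribution: its smooth global sections. -/
def sectionsOf [IsManifold 𝓘(ℝ, EuclideanSpace ℝ (Fin m)) ∞ M]
    (V : SubspaceField m M) : Set (VectField m M) :=
  {X | SmoothField X ∧ ∀ z, X z ∈ V z}

/-- `S + [F, S]`: all vector fields of the form `V₁ + [F, V₂]` with `V₁, V₂ ∈ S`. -/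
noncomputable def plusBracket (F : VectField m M) (S : Set (VectField m M)) : Set (VectField m M) :=
  {X | ∃ V₁ ∈ S, ∃ V₂ ∈ S, X = V₁ + bracket F V₂}

/-- The subspace of the tangent space at `z` spanned by the values of the fields in `S`. -/
noncomputable def valuesAt (S : Set (VectField m M)) (z : M) :
    Submodule ℝ (TangentSpace 𝓘(ℝ, EuclideanSpace ℝ (Fin m)) z) :=
  Submodule.span ℝ {v | ∃ X ∈ S, X z = v}

/-- A collection of vector fields is involutive if it is closed under the bracket. -/
def InvolutiveSystem (S : Set (VectField m M)) : Prop :=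
  ∀ X ∈ S, ∀ Y ∈ S, bracket X Y ∈ S

end

/-- The space of coordinate values `(t, x, y)`, with `k` coordinates `t` and `n` coordinates each
of type `x` and `y`. -/
abbrev TXY (k n : ℕ) : Type := (Fin k → ℝ) × (Fin n → ℝ) × (Fin n → ℝ)

/-- `TXY k n` as a manifold modelled on itself, with the identity as its only chart. -/
instance TXY.instChartedSpace (k n : ℕ) : ChartedSpace (TXY k n) (TXY k n) :=
  chartedSpaceSelf (TXY k n)

namespace TXY

variable {m k n : ℕ} {M : Type*} [TopologicalSpace M]
  [ChartedSpace (EuclideanSpace ℝ (Fin m)) M]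

/-- `φ` is a smooth coordinate system on its open domain: `φ` and its inverse are smooth. -/
def IsSmoothChart (m : ℕ) {M : Type*} [TopologicalSpace M]
    [ChartedSpace (EuclideanSpace ℝ (Fin m)) M] (φ : OpenPartialHomeomorph M (TXY k n)) : Prop :=
  ContMDiffOn 𝓘(ℝ, EuclideanSpace ℝ (Fin m)) 𝓘(ℝ, TXY k n) ∞ φ φ.source ∧
  ContMDiffOn 𝓘(ℝ, TXY k n) 𝓘(ℝ, EuclideanSpace ℝ (Fin m)) ∞ φ.symm φ.target

/-- The vector field on the domain of `φ` that has constant components `v` in the coordinates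
`φ`. -/
noncomputable def constField (φ : OpenPartialHomeomorph M (TXY k n)) (v : TXY k n) :
    VectField m M :=
  VectorField.mpullback 𝓘(ℝ, EuclideanSpace ℝ (Fin m)) 𝓘(ℝ, TXY k n) φ (fun _ => v)

/-- The coordinate vector field `∂/∂t^p`. -/
noncomputable def dt (φ : OpenPartialHomeomorph M (TXY k n)) (p : Fin k) : VectField m M :=
  constField φ (Pi.single p 1, 0, 0)

/-- The coordinate vector field `∂/∂x^i`. -/
noncomputable def dx (φ : OpenPartialHomeomorph M (TXY k n)) (i : Fin n) : VectField m M :=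
  constField φ (0, Pi.single i 1, 0)

/-- The coordinate vector field `∂/∂y^i`. -/
noncomputable def dy (φ : OpenPartialHomeomorph M (TXY k n)) (i : Fin n) : VectField m M :=
  constField φ (0, 0, Pi.single i 1)

/-- The value of the coordinate `y^i` at the point `z`. -/
def yCoord (φ : OpenPartialHomeomorph M (TXY k n)) (i : Fin n) (z : M) : ℝ := (φ z).2.2 i

/-- On the domain of `φ`, the `∂/∂y^i` span `V`, and the `∂/∂x^i` and `∂/∂y^i` together
span `W`. -/
def IsAdapted (φ : OpenPartialHomeomorph M (TXY k n)) (V W : SubspaceField m M) : Prop :=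
  ∀ z ∈ φ.source,
    V z = Submodule.span ℝ (Set.range fun i => dy φ i z) ∧
    W z = Submodule.span ℝ ((Set.range fun i => dx φ i z) ∪ Set.range fun i => dy φ i z)

end TXY

/-! One commutator identity carries the theorem. Let `X_i` be a local frame of `V` and `Y_i = [F,
X_i]`; by the dimension hypothesis the `X_i` and `Y_i` together form a frame of `W`. Frobenius for
`V` gives functions `x^i` that are constant along `V` and satisfy `Y_j x^i = δ` at the base point.
Put `y^i = F x^i`. Then `X_j y^i = F X_j x^i - Y_j x^i = -Y_j x^i`, so the `y^i` are independent
along `V` there. With functions `t^p` from Frobenius for `W` they form a chart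
(`IsProlongableFrame.exists_chart`). As `V` kills `t` and `x`, and `W` kills `t`, the chart is
adapted, and by its definition `y^i` is the coefficient of `∂/∂x^i` in `F`.

Only the values `F t^p` remain. In case (1) they vanish, because `F` lies in `W`. In case (2) one
needs `F t^1 = 1` and the other `t^p` invariant under `F` (`IsProlongableFrame.exists_time`). With
an extra real variable `r`, the fields `(X_i, 0)`, `(Y_i, 0)`, `(F, 1)` are involutive.
Transversality forces some first integral `u_j` to depend on `r`, and solving `u_j(z, σ(z)) = const`
gives a time function `σ`; the other first integrals, evaluated at `(z, σ(z))`, are the remaining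
`t^p`.

Frobenius itself (`exists_firstIntegrals`) is proved without flows. The distribution is written as
the graph of `a : E × G → (E →L[ℝ] G)`, and a point is transported inside its leaf over the segment
to the origin. This is an integral equation in a Banach space of curves, solved smoothly by the
implicit function theorem because superposition operators are smooth. The end point of the transport
is the first integral; involutivity enters through a linear differential equation with zero initial
value (`exists_firstIntegral_of_graph`). -/

section AdaptedCoordinates

open scoped Topology
open VectorField

/-! ### Superposition operators on spaces of continuous maps -/

section Superposition

variable (K : Type*) [TopologicalSpace K] [CompactSpace K]

/-- The pointwise extension of a bounded bilinear map to continuous maps. -/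
noncomputable def ContinuousMap.bilin {X Y Z : Type*} [NormedAddCommGroup X] [NormedSpace ℝ X]
    [NormedAddCommGroup Y] [NormedSpace ℝ Y] [NormedAddCommGroup Z] [NormedSpace ℝ Z]
    (B : X →L[ℝ] Y →L[ℝ] Z) : C(K, X) →L[ℝ] C(K, Y) →L[ℝ] C(K, Z) :=
  LinearMap.mkContinuous₂
    (LinearMap.mk₂ ℝ (fun (A : C(K, X)) (v : C(K, Y)) =>
        (⟨fun s => B (A s) (v s), by fun_prop⟩ : C(K, Z)))
      (fun A B v => by ext; simp) (fun c A v => by ext; simp)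
      (fun A v w => by ext; simp) (fun c A v => by ext; simp)) ‖B‖
    (fun A v => by
      rw [ContinuousMap.norm_le _ (by positivity)]
      intro s
      simp only [LinearMap.mk₂_apply, ContinuousMap.coe_mk]
      exact B.le_of_opNorm₂_le_of_le le_rfl (A.norm_coe_le_norm s) (v.norm_coe_le_norm s))

/-- Pointwise application of a continuous family of linear maps to a continuous family of
vectors, as a bounded bilinear map. -/
noncomputable def ContinuousMap.clmApply (E F : Type*) [NormedAddCommGroup E] [NormedSpace ℝ E]
    [NormedAddCommGroup F] [NormedSpace ℝ F] :=
  ContinuousMap.bilin K (X := E →L[ℝ] F) (Y := E) (Z := F) (ContinuousLinearMap.id ℝ _)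

variable {K}

@[simp] lemma ContinuousMap.clmApply_apply {E F : Type*} [NormedAddCommGroup E] [NormedSpace ℝ E]
    [NormedAddCommGroup F] [NormedSpace ℝ F] (A : C(K, E →L[ℝ] F)) (v : C(K, E)) (s : K) :
    ContinuousMap.clmApply K E F A v s = A s (v s) := rfl

/-- The derivative `f'` is uniformly continuous near the compact range of `γ`, so one `δ` serves all
`s` in the mean value inequality. This uniformity upgrades pointwise differentiability to the sup
norm. -/
lemma hasFDerivAt_superposition {E F : Type*} [NormedAddCommGroup E] [NormedSpace ℝ E]
    [NormedAddCommGroup F] [NormedSpace ℝ F] {f : E → F} {f' : E → E →L[ℝ] F}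
    (hf' : Continuous f') (h : ∀ x, HasFDerivAt f (f' x) x) (hf : Continuous f) (γ : C(K, E)) :
    HasFDerivAt (fun γ : C(K, E) => (⟨f, hf⟩ : C(E, F)).comp γ)
      (ContinuousMap.clmApply K E F ((⟨f', hf'⟩ : C(E, E →L[ℝ] F)).comp γ)) γ := by
  rw [hasFDerivAt_iff_isLittleO_nhds_zero, Asymptotics.isLittleO_iff]
  intro ε hε
  have hK : IsCompact (Set.range γ) := isCompact_range γ.continuous
  have hu := hK.uniformContinuousAt_of_continuousAt f' (fun x _ => hf'.continuousAt)
    (Metric.dist_mem_uniformity hε)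
  obtain ⟨δ, hδ, hδ'⟩ := Metric.mem_uniformity_dist.1 hu
  filter_upwards [Metric.ball_mem_nhds (0 : C(K, E)) hδ] with η hη
  rw [mem_ball_zero_iff] at hη
  rw [ContinuousMap.norm_le _ (by positivity)]
  intro s
  have hs : ‖η s‖ < δ := (η.norm_coe_le_norm s).trans_lt hη
  have key := (convex_ball (γ s) δ).norm_image_sub_le_of_norm_hasFDerivWithin_le'
    (f := f) (f' := f') (φ := f' (γ s)) (C := ε) (x := γ s) (y := γ s + η s)
    (fun x _ => (h x).hasFDerivWithinAt)
    (fun x hx => by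
      have := hδ' (a := γ s) (b := x) (by rwa [dist_comm]) ⟨s, rfl⟩
      rw [← dist_eq_norm, dist_comm]
      exact le_of_lt this)
    (Metric.mem_ball_self hδ) (by simpa using hs)
  simp only [add_sub_cancel_left] at key
  exact key.trans (mul_le_mul_of_nonneg_left (η.norm_coe_le_norm s) hε.le)

/-- The derivative of superposition by `f` is superposition by `f'` followed by the bounded linear
`clmApply`, so each order reduces to the previous one. The spaces are quantified inside the
induction because the target changes from `F` to `E →L[ℝ] F`. -/
lemma contDiff_nat_superposition (n : ℕ) : ∀ {E F : Type} [NormedAddCommGroup E] [NormedSpace ℝ E]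
    [NormedAddCommGroup F] [NormedSpace ℝ F] {f : E → F} (hf : ContDiff ℝ n f),
    ContDiff ℝ n (fun γ : C(K, E) => (⟨f, hf.continuous⟩ : C(E, F)).comp γ) := by
  induction n with
  | zero =>
    intro E F _ _ _ _ f hf
    exact contDiff_zero.2 (ContinuousMap.continuous_postcomp _)
  | succ n ih =>
    intro E F _ _ _ _ f hf
    obtain ⟨f', hf', h⟩ := contDiff_succ_iff_hasFDerivAt.1 (by exact_mod_cast hf)
    have key := contDiff_succ_iff_hasFDerivAt.2
      ⟨_, (ContinuousMap.clmApply K E F).contDiff.comp (ih hf'),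
        hasFDerivAt_superposition hf'.continuous h hf.continuous⟩
    rwa [← Nat.cast_succ] at key

/-- The superposition operator of a smooth map is smooth on spaces of continuous maps. -/
lemma contDiff_superposition {E F : Type} [NormedAddCommGroup E] [NormedSpace ℝ E]
    [NormedAddCommGroup F] [NormedSpace ℝ F] {f : E → F} (hf : ContDiff ℝ ∞ f) :
    ContDiff ℝ ∞ (fun γ : C(K, E) => (⟨f, hf.continuous⟩ : C(E, F)).comp γ) :=
  contDiff_infty.2 fun n => contDiff_nat_superposition n (contDiff_infty.1 hf n)

end Superposition

/-! ### Integration operator, inverse functions and cutoffs -/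

/-- Integration from the left end point, as an operator on continuous functions on the unit
interval. -/
noncomputable def unitInterval.primitive (G : Type*) [NormedAddCommGroup G] [NormedSpace ℝ G]
    [CompleteSpace G] : C(unitInterval, G) →L[ℝ] C(unitInterval, G) :=
  LinearMap.mkContinuous
    { toFun := fun γ => ⟨fun s => ∫ τ in (0 : ℝ)..s, γ (Set.projIcc 0 1 zero_le_one τ), by
        have hc : Continuous fun τ : ℝ => γ (Set.projIcc 0 1 zero_le_one τ) :=
          γ.continuous.comp continuous_projIcc
        exact (intervalIntegral.continuous_primitive
          (fun a b => hc.intervalIntegrable a b) 0).comp continuous_subtype_val⟩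
      map_add' := fun γ η => by
        ext s
        have hc (γ : C(unitInterval, G)) :
            Continuous fun τ : ℝ => γ (Set.projIcc 0 1 zero_le_one τ) :=
          γ.continuous.comp continuous_projIcc
        exact intervalIntegral.integral_add ((hc γ).intervalIntegrable _ _)
          ((hc η).intervalIntegrable _ _)
      map_smul' := fun c γ => by
        ext s
        exact intervalIntegral.integral_smul c _ } 1
    (fun γ => by
      rw [ContinuousMap.norm_le _ (by positivity)]
      intro s
      have := intervalIntegral.norm_integral_le_of_norm_le_const (a := 0) (b := (s : ℝ))
        (f := fun τ : ℝ => γ (Set.projIcc 0 1 zero_le_one τ)) (C := ‖γ‖)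
        (fun τ _ => γ.norm_coe_le_norm _)
      refine this.trans ?_
      rw [sub_zero, abs_of_nonneg s.2.1, one_mul]
      exact mul_le_of_le_one_right (norm_nonneg _) s.2.2)

/-- Clamping the argument to the unit interval extends `γ` continuously to the line, so the
derivatives are two-sided even at `0` and `1`. -/
lemma unitInterval.hasDerivAt_primitive {G : Type*} [NormedAddCommGroup G] [NormedSpace ℝ G]
    [CompleteSpace G] (γ : C(unitInterval, G)) :
    ∃ g : ℝ → G, g 0 = 0 ∧ (∀ s : unitInterval, g s = unitInterval.primitive G γ s) ∧
      ∀ s : unitInterval, HasDerivAt g (γ s) s := by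
  have hc : Continuous fun τ : ℝ => γ (Set.projIcc 0 1 zero_le_one τ) :=
    γ.continuous.comp continuous_projIcc
  refine ⟨fun t => ∫ τ in (0 : ℝ)..t, γ (Set.projIcc 0 1 zero_le_one τ), by simp, fun s => rfl,
    fun s => ?_⟩
  have := hc.integral_hasStrictDerivAt 0 (s : ℝ)
  simpa [Set.projIcc_val] using this.hasDerivAt

/-- Inverse function theorem for smooth maps, with a smooth inverse on an open set. -/
lemma exists_openPartialHomeomorph_of_hasFDerivAt {E F : Type*} [NormedAddCommGroup E]
    [NormedSpace ℝ E] [NormedAddCommGroup F] [NormedSpace ℝ F] [CompleteSpace E] {f : E → F}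
    {U : Set E} (hU : IsOpen U) (hf : ContDiffOn ℝ ∞ f U) {x : E} (hx : x ∈ U) {f' : E ≃L[ℝ] F}
    (h : HasFDerivAt f (f' : E →L[ℝ] F) x) :
    ∃ φ : OpenPartialHomeomorph E F, x ∈ φ.source ∧ φ.source ⊆ U ∧ (φ : E → F) = f ∧
      (∀ y ∈ φ.source, ∃ e : E ≃L[ℝ] F, HasFDerivAt f (e : E →L[ℝ] F) y) ∧
      ContDiffOn ℝ ∞ φ.symm φ.target := by
  have hfx : ContDiffAt ℝ ∞ f x := hf.contDiffAt (hU.mem_nhds hx)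
  let φ₀ := hfx.toOpenPartialHomeomorph f h (by simp)
  have hcont : ContinuousOn (fderiv ℝ f) U := hf.continuousOn_fderiv_of_isOpen hU (by simp)
  -- Invertibility of the derivative is an open condition; restricting to it makes the inverse
  -- smooth on the whole target and not only at the image of `x`.
  let U' : Set E := U ∩ fderiv ℝ f ⁻¹' Set.range (fun e : E ≃L[ℝ] F => (e : E →L[ℝ] F))
  have hU' : IsOpen U' := hcont.isOpen_inter_preimage hU ContinuousLinearEquiv.isOpen
  have hxU' : x ∈ U' := ⟨hx, f', h.fderiv.symm⟩
  let φ := φ₀.restrOpen U' hU'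
  have hd : ∀ y ∈ φ.source, ∃ e : E ≃L[ℝ] F, HasFDerivAt f (e : E →L[ℝ] F) y := by
    rintro y ⟨-, hyU, e, he⟩
    refine ⟨e, ?_⟩
    change (e : E →L[ℝ] F) = fderiv ℝ f y at he
    rw [he]
    exact ((hf.contDiffAt (hU.mem_nhds hyU)).differentiableAt (by simp)).hasFDerivAt
  refine ⟨φ, ⟨hfx.mem_toOpenPartialHomeomorph_source h (by simp), hxU'⟩, fun y hy => hy.2.1, rfl,
    hd, ?_⟩
  intro w hw
  have hs := φ.map_target hw
  obtain ⟨e, he⟩ := hd _ hs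
  exact (φ.contDiffAt_symm hw he (hf.contDiffAt (hU.mem_nhds hs.2.1))).contDiffWithinAt

/-- A smooth map on an open set agrees near a given point with a globally smooth map. -/
lemma exists_contDiff_eventuallyEq {E F : Type*} [NormedAddCommGroup E] [NormedSpace ℝ E]
    [FiniteDimensional ℝ E] [NormedAddCommGroup F] [NormedSpace ℝ F] {f : E → F} {U : Set E}
    (hU : IsOpen U) (hf : ContDiffOn ℝ ∞ f U) {x : E} (hx : x ∈ U) :
    ∃ g : E → F, ContDiff ℝ ∞ g ∧ g =ᶠ[𝓝 x] f := by
  obtain ⟨r, hr, hrU⟩ := Metric.nhds_basis_closedBall.mem_iff.1 (hU.mem_nhds hx)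
  let b : ContDiffBump x := ⟨r / 2, r, by positivity, by linarith⟩
  refine ⟨fun y => b y • f y, ?_, ?_⟩
  · rw [contDiff_iff_contDiffAt]
    intro y
    by_cases hy : y ∈ U
    · exact b.contDiff.contDiffAt.smul (hf.contDiffAt (hU.mem_nhds hy))
    · have : (fun y => b y • f y) =ᶠ[𝓝 y] fun _ => 0 := by
        have hmem : (tsupport b)ᶜ ∈ 𝓝 y := by
          refine (isClosed_tsupport _).isOpen_compl.mem_nhds fun h => hy (hrU ?_)
          rwa [b.tsupport_eq] at h
        filter_upwards [hmem] with z hz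
        rw [image_eq_zero_of_notMem_tsupport hz, zero_smul]
      exact contDiffAt_const.congr_of_eventuallyEq this
  · filter_upwards [b.eventuallyEq_one] with y hy
    simp [hy]

lemma hasFDerivAt_clm_comp {X Y Z : Type*} [NormedAddCommGroup X] [NormedSpace ℝ X]
    [NormedAddCommGroup Y] [NormedSpace ℝ Y] [NormedAddCommGroup Z] [NormedSpace ℝ Z]
    (L : Y →L[ℝ] Z) {f : X → Y} {f' : X →L[ℝ] Y} {x : X} (h : HasFDerivAt f f' x) :
    HasFDerivAt (fun x => L (f x)) (L.comp f') x :=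
  L.hasFDerivAt.comp x h

/-! ### Frobenius for graph distributions via an integral equation -/

namespace FrobeniusGraph

variable (E G : Type) [NormedAddCommGroup E] [NormedSpace ℝ E]
  [NormedAddCommGroup G] [NormedSpace ℝ G]

/-- Constant curves. -/
noncomputable def cst : G →L[ℝ] C(unitInterval, G) :=
  LinearMap.mkContinuous
    { toFun := fun y => ContinuousMap.const _ y
      map_add' := fun _ _ => by ext; simp
      map_smul' := fun _ _ => by ext; simp } 1
    (fun y => by
      rw [ContinuousMap.norm_le _ (by positivity)]
      intro s
      simp)

/-- The segment from `x` to the origin. -/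
noncomputable def ramp : E →L[ℝ] C(unitInterval, E) :=
  LinearMap.mkContinuous
    { toFun := fun x => ⟨fun s => (1 - (s : ℝ)) • x, by fun_prop⟩
      map_add' := fun _ _ => by ext; simp
      map_smul' := fun _ _ => by ext; exact smul_comm _ _ _ } 1
    (fun x => by
      rw [ContinuousMap.norm_le _ (by positivity)]
      intro s
      simp only [LinearMap.coe_mk, AddHom.coe_mk, ContinuousMap.coe_mk, norm_smul]
      have h0 := s.2.1
      have h1 := s.2.2
      gcongr
      rw [Real.norm_eq_abs, abs_of_nonneg (by linarith)]
      linarith)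

/-- The curve lying over the segment from `x` to the origin with given `G`-component. -/
noncomputable def lift : (E × G) × C(unitInterval, G) →L[ℝ] C(unitInterval, E × G) :=
  (ContinuousLinearMap.compLeftContinuous ℝ unitInterval (ContinuousLinearMap.inl ℝ E G)).comp
    ((ramp E).comp ((ContinuousLinearMap.fst ℝ E G).comp (ContinuousLinearMap.fst ℝ _ _))) +
  (ContinuousLinearMap.compLeftContinuous ℝ unitInterval (ContinuousLinearMap.inr ℝ E G)).comp
    (ContinuousLinearMap.snd ℝ _ _)

variable {E G}

@[simp] lemma cst_apply (y : G) (s : unitInterval) : cst G y s = y := rfl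

@[simp] lemma lift_apply (q : (E × G) × C(unitInterval, G)) (s : unitInterval) :
    lift E G q s = ((1 - (s : ℝ)) • q.1.1, q.2 s) := by
  have h : ramp E q.1.1 s = (1 - (s : ℝ)) • q.1.1 := rfl
  simp [lift, ContinuousLinearMap.compLeftContinuous, h]

variable {a : E × G → E →L[ℝ] G} (ha : ContDiff ℝ ∞ a)

/-- The derivative of the integrand in `defect`. -/
noncomputable def integrandDeriv (q : (E × G) × C(unitInterval, G)) :
    (E × G) × C(unitInterval, G) →L[ℝ] C(unitInterval, G) :=
  (ContinuousMap.clmApply unitInterval E G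
      ((⟨a, ha.continuous⟩ : C(E × G, E →L[ℝ] G)).comp (lift E G q))).comp
    ((cst E).comp ((ContinuousLinearMap.fst ℝ E G).comp (ContinuousLinearMap.fst ℝ _ _))) +
  ((ContinuousMap.clmApply unitInterval E G).comp
    ((ContinuousMap.clmApply unitInterval (E × G) (E →L[ℝ] G)
      ((⟨fderiv ℝ a, ha.continuous_fderiv (by simp)⟩ :
        C(E × G, E × G →L[ℝ] E →L[ℝ] G)).comp (lift E G q))).comp (lift E G))).flip
    (cst E q.1.1)

lemma integrandDeriv_apply (q r : (E × G) × C(unitInterval, G)) (s : unitInterval) :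
    integrandDeriv ha q r s =
      a (lift E G q s) r.1.1 + fderiv ℝ a (lift E G q s) (lift E G r s) q.1.1 := rfl

variable [CompleteSpace G]

/-- The integral equation of the curves in the leaves lying over segments to the origin. -/
noncomputable def defect (q : (E × G) × C(unitInterval, G)) : C(unitInterval, G) :=
  q.2 - cst G q.1.2 + unitInterval.primitive G (ContinuousMap.clmApply unitInterval E G
    ((⟨a, ha.continuous⟩ : C(E × G, E →L[ℝ] G)).comp (lift E G q)) (cst E q.1.1))

/-- The derivative of `defect`. -/
noncomputable def defectDeriv (q : (E × G) × C(unitInterval, G)) :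
    (E × G) × C(unitInterval, G) →L[ℝ] C(unitInterval, G) :=
  ContinuousLinearMap.snd ℝ _ _ -
    (cst G).comp ((ContinuousLinearMap.snd ℝ E G).comp (ContinuousLinearMap.fst ℝ _ _)) +
  (unitInterval.primitive G).comp (integrandDeriv ha q)

lemma contDiff_defect : ContDiff ℝ ∞ (defect ha) := by
  have h := (contDiff_superposition (K := unitInterval) ha).comp (lift E G).contDiff
  unfold defect
  refine (contDiff_snd.sub ((cst G).contDiff.comp (contDiff_snd.comp contDiff_fst))).add
    ((unitInterval.primitive G).contDiff.comp ?_)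
  exact ((ContinuousMap.clmApply unitInterval E G).contDiff.comp h).clm_apply
    ((cst E).contDiff.comp (contDiff_fst.comp contDiff_fst))

lemma hasFDerivAt_defect (q : (E × G) × C(unitInterval, G)) :
    HasFDerivAt (defect ha) (defectDeriv ha q) q := by
  have hN := (hasFDerivAt_superposition (K := unitInterval) (f := a) (f' := fderiv ℝ a)
    (ha.continuous_fderiv (by simp)) (fun x => (ha.differentiable (by simp) x).hasFDerivAt)
    ha.continuous (lift E G q)).comp q (lift E G).hasFDerivAt
  have hc : HasFDerivAt (fun q : (E × G) × C(unitInterval, G) => cst E q.1.1)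
      ((cst E).comp ((ContinuousLinearMap.fst ℝ E G).comp (ContinuousLinearMap.fst ℝ _ _))) q :=
    ((cst E).comp ((ContinuousLinearMap.fst ℝ E G).comp
      (ContinuousLinearMap.fst ℝ (E × G) C(unitInterval, G)))).hasFDerivAt
  have hA := hasFDerivAt_clm_comp (Z := C(unitInterval, E) →L[ℝ] C(unitInterval, G))
    (ContinuousMap.clmApply unitInterval E G) hN
  have hB := hA.clm_apply hc
  have hJ := (unitInterval.primitive G).hasFDerivAt.comp q hB
  have hl : HasFDerivAt (fun q : (E × G) × C(unitInterval, G) => q.2 - cst G q.1.2)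
      (ContinuousLinearMap.snd ℝ _ _ -
        (cst G).comp ((ContinuousLinearMap.snd ℝ E G).comp (ContinuousLinearMap.fst ℝ _ _))) q :=
    ContinuousLinearMap.hasFDerivAt (ContinuousLinearMap.snd ℝ (E × G) C(unitInterval, G) -
        (cst G).comp ((ContinuousLinearMap.snd ℝ E G).comp (ContinuousLinearMap.fst ℝ _ _)))
  exact hl.add hJ

lemma defect_zero (y : G) : defect ha ((0, y), cst G y) = 0 := by
  simp [defect]

/-- Near a point over the origin, the integral equation is solved by curves depending smoothly on
the end point. -/
lemma exists_solution [CompleteSpace E] (z₀ : G) :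
    ∃ T : Set (E × G), IsOpen T ∧ (0, z₀) ∈ T ∧ ∃ Γ : E × G → C(unitInterval, G),
      ContDiffOn ℝ ∞ Γ T ∧ Γ (0, z₀) = cst G z₀ ∧ ∀ p ∈ T, defect ha (p, Γ p) = 0 := by
  -- The implicit function theorem, as the inverse function theorem for the map that keeps the end
  -- point data and records the defect.
  let Ψ : (E × G) × C(unitInterval, G) → (E × G) × C(unitInterval, G) :=
    fun q => (q.1, defect ha q)
  let q₀ : (E × G) × C(unitInterval, G) := ((0, z₀), cst G z₀)
  have hΨ : ContDiff ℝ ∞ Ψ := contDiff_fst.prodMk (contDiff_defect ha)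
  let S : E × G →L[ℝ] C(unitInterval, G) :=
    (defectDeriv ha q₀).comp (ContinuousLinearMap.inl ℝ _ _)
  let e : ((E × G) × C(unitInterval, G)) ≃L[ℝ] ((E × G) × C(unitInterval, G)) :=
    (ContinuousLinearEquiv.refl ℝ (E × G)).skewProd
      (ContinuousLinearEquiv.refl ℝ C(unitInterval, G)) S
  have he : HasFDerivAt Ψ (e : _ →L[ℝ] _) q₀ := by
    have h := (hasFDerivAt_fst (𝕜 := ℝ) (p := q₀)).prodMk (hasFDerivAt_defect ha q₀)
    refine h.congr_fderiv (ContinuousLinearMap.ext fun r => Prod.ext rfl ?_)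
    -- Over the origin the segment has zero velocity, so the integral term does not feel a variation
    -- of the curve and the partial derivative in the curve is the identity. Smallness of the base
    -- point thus replaces a short time interval.
    have h2 : defectDeriv ha q₀ (0, r.2) = r.2 := by
      have h4 : integrandDeriv ha q₀ (0, r.2) = 0 := by
        ext s
        simp [integrandDeriv_apply, q₀]
      simp [defectDeriv, h4]
    have h3 : r = (r.1, 0) + (0, r.2) := by simp
    change defectDeriv ha q₀ r = r.2 + defectDeriv ha q₀ (r.1, 0)
    conv_lhs => rw [h3, map_add, h2, add_comm]
  obtain ⟨φ, hφ₀, -, hφ, -, hs⟩ :=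
    exists_openPartialHomeomorph_of_hasFDerivAt isOpen_univ hΨ.contDiffOn (Set.mem_univ q₀) he
  have hι : Continuous fun p : E × G => (p, (0 : C(unitInterval, G))) := by fun_prop
  have hΨ₀ : Ψ q₀ = ((0, z₀), 0) := Prod.ext rfl (defect_zero ha z₀)
  refine ⟨(fun p => (p, (0 : C(unitInterval, G)))) ⁻¹' φ.target, φ.open_target.preimage hι, ?_,
    fun p => (φ.symm (p, 0)).2, ?_, ?_, ?_⟩
  · have := φ.map_source hφ₀
    rw [hφ, hΨ₀] at this
    exact this
  · exact contDiff_snd.comp_contDiffOn (hs.comp (contDiff_id.prodMk contDiff_const).contDiffOn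
      fun p hp => hp)
  · have := φ.left_inv hφ₀
    rw [hφ, hΨ₀] at this
    simp only [this, q₀]
  · intro p hp
    have h := φ.right_inv hp
    rw [hφ] at h
    have h1 : (φ.symm (p, 0)).1 = p := congrArg Prod.fst h
    have h2 : defect ha (φ.symm (p, 0)) = 0 := congrArg Prod.snd h
    have h3 : φ.symm (p, 0) = (p, (φ.symm (p, 0)).2) := Prod.ext h1 rfl
    rw [h3] at h2
    exact h2

lemma solution_over_origin {y : G} {γ : C(unitInterval, G)} (h : defect ha ((0, y), γ) = 0) :
    γ = cst G y := by
  simpa [defect, sub_eq_zero] using h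

/-- A variation of the starting point tangent to the leaf should stay tangent to it, and hence equal
`(1 - s) • (ξ, a ξ)` along the curve, which vanishes at `s = 1`. The deviation from this expected
variation solves a homogeneous linear equation with initial value zero. -/
lemma apply_eq_of_defectDeriv_eq_zero {p : E × G} {γ η : C(unitInterval, G)} {ξ : E}
    (hγ : defect ha (p, γ) = 0) (hη : defectDeriv ha (p, γ) ((ξ, a p ξ), η) = 0)
    (hint : ∀ s, ∀ ξ η : E,
      fderiv ℝ a (lift E G (p, γ) s) (ξ, a (lift E G (p, γ) s) ξ) η =
      fderiv ℝ a (lift E G (p, γ) s) (η, a (lift E G (p, γ) s) η) ξ) :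
    η 1 = 0 := by
  obtain ⟨g, hg0, hg, hg'⟩ := unitInterval.hasDerivAt_primitive
    (ContinuousMap.clmApply unitInterval E G
      ((⟨a, ha.continuous⟩ : C(E × G, E →L[ℝ] G)).comp (lift E G (p, γ))) (cst E p.1))
  obtain ⟨k, hk0, hk, hk'⟩ := unitInterval.hasDerivAt_primitive
    (integrandDeriv ha (p, γ) ((ξ, a p ξ), η))
  have hγs : ∀ s : unitInterval, γ s = p.2 - g s := by
    intro s
    have := congrArg (fun c : C(unitInterval, G) => c s) hγ
    simp only [defect, ContinuousMap.add_apply, ContinuousMap.sub_apply, cst_apply, ← hg s,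
      ContinuousMap.zero_apply] at this
    rw [← sub_eq_zero, ← this]; abel
  have hηs : ∀ s : unitInterval, η s = a p ξ - k s := by
    intro s
    have := congrArg (fun c : C(unitInterval, G) => c s) hη
    rw [hk s, ← sub_eq_zero, ← ContinuousMap.zero_apply (β := G) s, ← this]
    simp only [defectDeriv, add_apply, sub_apply,
      ContinuousLinearMap.comp_apply, ContinuousMap.add_apply, ContinuousMap.sub_apply,
      ContinuousLinearMap.coe_snd', ContinuousLinearMap.coe_fst', cst_apply]
    abel
  let w : ℝ → E × G := fun t => ((1 - t) • p.1, p.2 - g t)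
  have hw : ∀ s : unitInterval, lift E G (p, γ) s = w s := fun s => by
    simp [w, hγs]
  -- By `hηs`, `f` is the `G`-component of the variation minus the one tangent to the leaf.
  let f : ℝ → G := fun t => a p ξ - k t - (1 - t) • a (w t) ξ
  have hw' : ∀ s : unitInterval, HasDerivAt w (-p.1, -(a (w s) p.1)) s := by
    intro s
    have h1 : HasDerivAt (fun t : ℝ => (1 - t) • p.1) (-p.1) s := by
      simpa using ((hasDerivAt_id (s : ℝ)).const_sub 1).smul_const p.1
    have h2 : HasDerivAt (fun t : ℝ => p.2 - g t) (-(a (w s) p.1)) s := by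
      have := (hg' s).const_sub p.2
      simpa [hw s] using this
    exact h1.prodMk h2
  have hf : ∀ s : unitInterval, HasDerivAt f (-(fderiv ℝ a (w s) (0, f s) p.1)) s := by
    intro s
    have h1 := (hk' s).const_sub (a p ξ)
    have h2 : HasDerivAt (fun t => a (w t) ξ)
        (fderiv ℝ a (w s) (-p.1, -(a (w s) p.1)) ξ) s := by
      have h := ((ha.differentiable (by simp) (w s)).hasFDerivAt).comp_hasDerivAt (s : ℝ) (hw' s)
      exact ((ContinuousLinearMap.apply ℝ G ξ).hasFDerivAt).comp_hasDerivAt (s : ℝ) h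
    have h3 := ((hasDerivAt_id (s : ℝ)).const_sub 1).smul h2
    have h4 : HasDerivAt f _ s := h1.sub h3
    refine h4.congr_deriv ?_
    -- Integrability exchanges `p.1` and `ξ`; all terms then cancel except the one linear in `f`.
    have hsym := hint s p.1 ξ
    rw [hw s] at hsym
    have e1 : (-p.1, -(a (w s) p.1)) = -(p.1, a (w s) p.1) := rfl
    have e2 : ((0 : E), f s) = ((1 - (s : ℝ)) • ξ, η s) - (1 - (s : ℝ)) • (ξ, a (w s) ξ) := by
      simp [f, hηs]
    rw [e1, e2]
    simp only [map_sub, map_neg, map_smul, sub_apply, neg_apply, smul_apply, hsym,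
      integrandDeriv_apply, hw s, lift_apply, id_eq]
    module
  -- Compactness of the curve bounds the coefficient of the linear equation, as the Grönwall-type
  -- uniqueness in `key` requires.
  obtain ⟨C, hC⟩ := isCompact_univ.exists_bound_of_continuousOn (s := Set.univ)
    (f := fun s : unitInterval => ‖fderiv ℝ a (lift E G (p, γ) s)‖)
    ((ha.continuous_fderiv (by simp)).comp (lift E G (p, γ)).continuous).norm.continuousOn
  have hf0 : f 0 = 0 := by
    have h0 : w 0 = p := by simp [w, hg0]
    simp [f, hk0, h0]
  have key := eq_zero_of_abs_deriv_le_mul_abs_self_of_eq_zero_right (f := f)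
    (f' := fun t => -(fderiv ℝ a (w t) (0, f t) p.1)) (K := C * ‖p.1‖) (a := 0) (b := 1)
    (fun t ht => (hf ⟨t, ht⟩).continuousAt.continuousWithinAt)
    (fun t ht => (hf ⟨t, ht.1, ht.2.le⟩).hasDerivWithinAt) hf0
    (fun t ht => by
      have h1 : ‖fderiv ℝ a (w t)‖ ≤ C := by
        have := hC ⟨t, ht.1, ht.2.le⟩ (Set.mem_univ _)
        rw [hw] at this
        exact (le_abs_self _).trans this
      rw [norm_neg]
      have h2 : ‖((0 : E), f t)‖ ≤ ‖f t‖ := by simp [Prod.norm_def]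
      calc ‖fderiv ℝ a (w t) (0, f t) p.1‖
          ≤ ‖fderiv ℝ a (w t) (0, f t)‖ * ‖p.1‖ := ContinuousLinearMap.le_opNorm _ _
        _ ≤ (C * ‖f t‖) * ‖p.1‖ := by
            gcongr
            exact ContinuousLinearMap.le_of_opNorm_le_of_le _ h1 h2
        _ = C * ‖p.1‖ * ‖f t‖ := by ring) 1 (by simp)
  have h1 := hηs 1
  simp only [Set.Icc.coe_one] at h1
  simpa [f, ← h1] using key

end FrobeniusGraph

open FrobeniusGraph in
/-- Frobenius theorem for the distribution of graphs of the linear maps `a p`: under the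
integrability condition there is a first integral that is the identity over the origin. -/
theorem exists_firstIntegral_of_graph {E G : Type} [NormedAddCommGroup E] [NormedSpace ℝ E]
    [NormedAddCommGroup G] [NormedSpace ℝ G] [CompleteSpace E] [CompleteSpace G]
    {a : E × G → E →L[ℝ] G} (ha : ContDiff ℝ ∞ a) (z₀ : G)
    (hint : ∀ᶠ p in 𝓝 ((0 : E), z₀), ∀ ξ η : E,
      fderiv ℝ a p (ξ, a p ξ) η = fderiv ℝ a p (η, a p η) ξ) :
    ∃ N : Set (E × G), IsOpen N ∧ (0, z₀) ∈ N ∧ ∃ u : E × G → G, ContDiffOn ℝ ∞ u N ∧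
      (∀ y, (0, y) ∈ N → u (0, y) = y) ∧ ∀ p ∈ N, ∀ ξ, fderiv ℝ u p (ξ, a p ξ) = 0 := by
  obtain ⟨T, hT, hT₀, Γ, hΓ, hΓ₀, hΓd⟩ := exists_solution ha z₀
  obtain ⟨ε, hε, hεS⟩ := Metric.eventually_nhds_iff.1 hint
  have hc : ContinuousOn (fun p => lift E G (p, Γ p)) T :=
    (lift E G).continuous.comp_continuousOn (continuousOn_id.prodMk hΓ.continuousOn)
  -- Integrability is known only within `ε` of the base point. Closeness in the sup norm keeps the
  -- whole curve there, not just its end points.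
  let N := T ∩ (fun p => lift E G (p, Γ p)) ⁻¹' Metric.ball (lift E G ((0, z₀), cst G z₀)) ε
  have hN : IsOpen N := hc.isOpen_inter_preimage hT Metric.isOpen_ball
  refine ⟨N, hN, ⟨hT₀, ?_⟩, fun p => Γ p 1, ?_, ?_, ?_⟩
  · simp only [Set.mem_preimage, hΓ₀]
    exact Metric.mem_ball_self hε
  · exact (ContinuousMap.evalCLM ℝ (1 : unitInterval)).contDiff.comp_contDiffOn
      (hΓ.mono Set.inter_subset_left)
  · intro y hy
    have := solution_over_origin ha (hΓd _ hy.1)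
    simp [this]
  · intro p hp ξ
    have hΓp : HasFDerivAt Γ (fderiv ℝ Γ p) p :=
      ((hΓ.contDiffAt (hT.mem_nhds hp.1)).differentiableAt (by simp)).hasFDerivAt
    have hu := (ContinuousMap.evalCLM ℝ (1 : unitInterval)).hasFDerivAt.comp p hΓp
    change fderiv ℝ (⇑(ContinuousMap.evalCLM ℝ (1 : unitInterval)) ∘ Γ) p _ = 0
    rw [hu.fderiv]
    -- Differentiating the identity `defect ha (q, Γ q) = 0` yields the linearised equation for the
    -- variation of `Γ`.
    have hd := (hasFDerivAt_defect ha (p, Γ p)).comp p ((hasFDerivAt_id p).prodMk hΓp)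
    have h0 : (defect ha ∘ fun q => (id q, Γ q)) =ᶠ[𝓝 p] fun _ => 0 := by
      filter_upwards [hT.mem_nhds hp.1] with q hq using hΓd q hq
    have hz := (hd.congr_of_eventuallyEq h0.symm).unique (hasFDerivAt_const _ _)
    refine apply_eq_of_defectDeriv_eq_zero ha (p := p) (γ := Γ p) (ξ := ξ)
      (η := fderiv ℝ Γ p (ξ, a p ξ)) (hΓd p hp.1) ?_ ?_
    · exact congrArg (fun L : E × G →L[ℝ] C(unitInterval, G) => L (ξ, a p ξ)) hz
    · intro s
      refine hεS ?_
      have h1 : dist (lift E G (p, Γ p)) (lift E G ((0, z₀), cst G z₀)) < ε := hp.2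
      have h2 := (ContinuousMap.dist_apply_le_dist (f := lift E G (p, Γ p))
        (g := lift E G ((0, z₀), cst G z₀)) s).trans_lt h1
      simpa using h2

/-- The invertible operators form an open set, on which inversion is smooth. -/
lemma exists_contDiffOn_inverse {E P : Type*} [NormedAddCommGroup E] [NormedSpace ℝ E]
    [NormedAddCommGroup P] [NormedSpace ℝ P] [CompleteSpace P] {A : E → P →L[ℝ] P} {U : Set E}
    (hU : IsOpen U) (hA : ContDiffOn ℝ ∞ A U) {z₀ : E} (hz₀ : z₀ ∈ U)
    (h₀ : A z₀ = ContinuousLinearMap.id ℝ P) :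
    ∃ N : Set E, IsOpen N ∧ z₀ ∈ N ∧ N ⊆ U ∧ ∃ R : E → P →L[ℝ] P, ContDiffOn ℝ ∞ R N ∧
      ∀ z ∈ N, (∀ v, A z (R z v) = v) ∧ ∀ v, R z (A z v) = v := by
  let N : Set E := U ∩ A ⁻¹' Set.range (fun e : P ≃L[ℝ] P => (e : P →L[ℝ] P))
  have hN : IsOpen N := hA.continuousOn.isOpen_inter_preimage hU ContinuousLinearEquiv.isOpen
  refine ⟨N, hN, ⟨hz₀, ContinuousLinearEquiv.refl ℝ P, h₀.symm⟩, Set.inter_subset_left,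
    fun z => (A z).inverse, ?_, ?_⟩
  · rintro z ⟨hzU, e, he⟩
    have h1 := contDiffAt_map_inverse (𝕜 := ℝ) (n := ∞) e
    change (e : P →L[ℝ] P) = A z at he
    rw [he] at h1
    exact (h1.comp z (hA.contDiffAt (hU.mem_nhds hzU))).contDiffWithinAt
  · rintro z ⟨-, e, he⟩
    change (e : P →L[ℝ] P) = A z at he
    simp [← he]

/-! ### Frames as families of linear maps -/

section Frame

variable {E ι : Type*} [NormedAddCommGroup E] [NormedSpace ℝ E] [Fintype ι]

/-- The linear combinations of the vector fields `Z i` at a point. -/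
noncomputable def frame (Z : ι → E → E) (z : E) : (ι → ℝ) →L[ℝ] E :=
  ∑ i, (ContinuousLinearMap.proj (R := ℝ) (φ := fun _ : ι => ℝ) i).smulRight (Z i z)

lemma frame_apply (Z : ι → E → E) (z : E) (c : ι → ℝ) : frame Z z c = ∑ i, c i • Z i z := by
  simp [frame]

lemma frame_single [DecidableEq ι] (Z : ι → E → E) (z : E) (i : ι) :
    frame Z z (Pi.single i 1) = Z i z := by
  simp [frame_apply, Pi.single_apply]

lemma range_frame (Z : ι → E → E) (z : E) :
    LinearMap.range (frame Z z : (ι → ℝ) →ₗ[ℝ] E) =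
      Submodule.span ℝ (Set.range fun i => Z i z) := by
  rw [← Fintype.range_linearCombination ℝ]
  congr 1
  ext c : 1
  simp [frame_apply, Fintype.linearCombination_apply]

lemma frame_injective {Z : ι → E → E} {z : E} (h : LinearIndependent ℝ fun i => Z i z) :
    Function.Injective (frame Z z) := by
  have := LinearIndependent.fintypeLinearCombination_injective h
  intro c d hcd
  apply this
  simpa [frame_apply, Fintype.linearCombination_apply] using hcd

lemma contDiffOn_frame {Z : ι → E → E} {U : Set E} (hZ : ∀ i, ContDiffOn ℝ ∞ (Z i) U) :
    ContDiffOn ℝ ∞ (frame Z) U := by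
  unfold frame
  exact ContDiffOn.sum fun i _ =>
    ((ContinuousLinearMap.smulRightL ℝ (ι → ℝ) E
      (ContinuousLinearMap.proj (R := ℝ) (φ := fun _ : ι => ℝ) i)).contDiff.comp_contDiffOn (hZ i))

lemma fderiv_frame_apply {Z : ι → E → E} {z : E} (hZ : ∀ i, DifferentiableAt ℝ (Z i) z)
    (hd : DifferentiableAt ℝ (frame Z) z) (v : E) (c : ι → ℝ) :
    fderiv ℝ (frame Z) z v c = ∑ i, c i • fderiv ℝ (Z i) z v := by
  have h1 : HasFDerivAt (fun y => frame Z y c)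
      ((ContinuousLinearMap.apply ℝ E c).comp (fderiv ℝ (frame Z) z)) z :=
    (ContinuousLinearMap.apply ℝ E c).hasFDerivAt.comp z hd.hasFDerivAt
  have h2 : HasFDerivAt (fun y => frame Z y c) (∑ i, c i • fderiv ℝ (Z i) z) z := by
    simp only [frame_apply]
    exact HasFDerivAt.fun_sum fun i _ => (hZ i).hasFDerivAt.const_smul (c i)
  have := congrArg (fun L : E →L[ℝ] E => L v) (h1.unique h2)
  simpa using this

/-- With constant coefficients `c` and `d` no derivatives of coefficients appear, so the
antisymmetrised derivative is exactly `∑ c i * d j • [Z i, Z j]`. This is the form in which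
involutivity meets the integrability condition for graphs. -/
lemma fderiv_frame_sub_mem {Z : ι → E → E} {z : E} (hZ : ∀ i, DifferentiableAt ℝ (Z i) z)
    (hd : DifferentiableAt ℝ (frame Z) z)
    (hbr : ∀ i j, lieBracket ℝ (Z i) (Z j) z ∈ Submodule.span ℝ (Set.range fun i => Z i z))
    (c d : ι → ℝ) :
    ∃ e, fderiv ℝ (frame Z) z (frame Z z c) d - fderiv ℝ (frame Z) z (frame Z z d) c =
      frame Z z e := by
  have hmem : fderiv ℝ (frame Z) z (frame Z z c) d - fderiv ℝ (frame Z) z (frame Z z d) c ∈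
      Submodule.span ℝ (Set.range fun i => Z i z) := by
    have : fderiv ℝ (frame Z) z (frame Z z c) d - fderiv ℝ (frame Z) z (frame Z z d) c =
        ∑ i, ∑ j, (c i * d j) • lieBracket ℝ (Z i) (Z j) z := by
      rw [fderiv_frame_apply hZ hd, fderiv_frame_apply hZ hd]
      simp only [frame_apply, map_sum, map_smul, Finset.smul_sum, lieBracket, smul_sub,
        Finset.sum_sub_distrib, smul_smul]
      congr 1
      rw [Finset.sum_comm]
      simp only [mul_comm]
    rw [this]
    exact Submodule.sum_mem _ fun i _ => Submodule.sum_mem _ fun j _ =>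
      Submodule.smul_mem _ _ (hbr i j)
  rw [← range_frame] at hmem
  obtain ⟨e, he⟩ := hmem
  exact ⟨e, he.symm⟩

/-- A complement of the span supplies the second factor. The frame is straightened at the single
point `z`, which is enough to make nearby spans graphs. -/
lemma exists_equiv_frame [FiniteDimensional ℝ E] {Z : ι → E → E} {z : E}
    (h : LinearIndependent ℝ fun i => Z i z) {k : ℕ} (hk : k + Fintype.card ι = finrank ℝ E) :
    ∃ Λ : E ≃L[ℝ] (ι → ℝ) × (Fin k → ℝ), ∀ c, Λ (frame Z z c) = (c, 0) := by
  obtain ⟨T, hT⟩ := Submodule.exists_isCompl (LinearMap.range (frame Z z : (ι → ℝ) →ₗ[ℝ] E))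
  let e₁ : (ι → ℝ) ≃ₗ[ℝ] LinearMap.range (frame Z z : (ι → ℝ) →ₗ[ℝ] E) :=
    LinearEquiv.ofInjective _ (frame_injective h)
  have hfin : finrank ℝ (Fin k → ℝ) = finrank ℝ T := by
    have h1 := Submodule.finrank_add_eq_of_isCompl hT
    have h2 := e₁.finrank_eq
    simp only [Module.finrank_fintype_fun_eq_card, Fintype.card_fin] at h2 ⊢
    omega
  let e₂ : (Fin k → ℝ) ≃ₗ[ℝ] T := LinearEquiv.ofFinrankEq _ _ hfin
  let e : ((ι → ℝ) × (Fin k → ℝ)) ≃ₗ[ℝ] E :=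
    (e₁.prodCongr e₂).trans (Submodule.prodEquivOfIsCompl _ _ hT)
  refine ⟨e.symm.toContinuousLinearEquiv, fun c => ?_⟩
  change e.symm (frame Z z c) = (c, 0)
  rw [LinearEquiv.symm_apply_eq]
  simp [e, e₁]

end Frame

/-! ### Frobenius for involutive frames -/

/-- The Frobenius theorem: an involutive frame has a complete set of local first integrals. -/
theorem exists_firstIntegrals {E ι : Type} [NormedAddCommGroup E] [NormedSpace ℝ E]
    [FiniteDimensional ℝ E] [Fintype ι] {Z : ι → E → E} {U : Set E} (hU : IsOpen U)
    (hZ : ∀ i, ContDiffOn ℝ ∞ (Z i) U) {z₀ : E} (hz₀ : z₀ ∈ U)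
    (hind : LinearIndependent ℝ fun i => Z i z₀)
    (hbr : ∀ z ∈ U, ∀ i j,
      lieBracket ℝ (Z i) (Z j) z ∈ Submodule.span ℝ (Set.range fun i => Z i z))
    {k : ℕ} (hk : k + Fintype.card ι = finrank ℝ E) :
    ∃ N : Set E, IsOpen N ∧ z₀ ∈ N ∧ N ⊆ U ∧ ∃ u : E → (Fin k → ℝ), ContDiffOn ℝ ∞ u N ∧
      (∀ z ∈ N, ∀ i, fderiv ℝ u z (Z i z) = 0) ∧
      ∀ v, fderiv ℝ u z₀ v = 0 → v ∈ Submodule.span ℝ (Set.range fun i => Z i z₀) := by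
  classical
  obtain ⟨Λ, hΛ⟩ := exists_equiv_frame hind hk
  let pt : (ι → ℝ) × (Fin k → ℝ) → E := fun w => z₀ + Λ.symm w
  have hpt : ContDiff ℝ ∞ pt := contDiff_const.add Λ.symm.contDiff
  have hpt' : ∀ w, HasFDerivAt pt (Λ.symm : _ →L[ℝ] E) w := fun w =>
    Λ.symm.hasFDerivAt.const_add z₀
  have hpt₀ : pt 0 = z₀ := by simp [pt]
  let U' := pt ⁻¹' U
  have hU' : IsOpen U' := hU.preimage hpt.continuous
  have h0U' : (0 : (ι → ℝ) × (Fin k → ℝ)) ∈ U' := by simpa [U', hpt₀] using hz₀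
  have hfr := contDiffOn_frame hZ
  let B : (ι → ℝ) × (Fin k → ℝ) → (ι → ℝ) →L[ℝ] (ι → ℝ) × (Fin k → ℝ) :=
    fun w => (Λ : E →L[ℝ] _).comp (frame Z (pt w))
  have hB : ContDiffOn ℝ ∞ B U' :=
    contDiffOn_const.clm_comp (hfr.comp hpt.contDiffOn fun w hw => hw)
  have hB₀ : ∀ c, B 0 c = (c, 0) := fun c => by simp [B, hpt₀, hΛ]
  have hBd : ∀ w ∈ U', ∀ v c,
      fderiv ℝ B w v c = Λ (fderiv ℝ (frame Z) (pt w) (Λ.symm v) c) := by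
    intro w hw v c
    have h1 : HasFDerivAt (frame Z) (fderiv ℝ (frame Z) (pt w)) (pt w) :=
      ((hfr.contDiffAt (hU.mem_nhds hw)).differentiableAt (by simp)).hasFDerivAt
    have h2 := hasFDerivAt_clm_comp (ContinuousLinearMap.compL ℝ (ι → ℝ) E
      ((ι → ℝ) × (Fin k → ℝ)) (Λ : E →L[ℝ] _)) (h1.comp w (hpt' w))
    have h3 : fderiv ℝ B w = _ := h2.fderiv
    rw [h3]
    rfl
  obtain ⟨N₁, hN₁, h0N₁, hN₁U, R, hR, hRB⟩ := exists_contDiffOn_inverse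
    (A := fun w => (ContinuousLinearMap.fst ℝ _ _).comp (B w)) hU'
    (contDiffOn_const.clm_comp hB) h0U' (by ext c : 1; simp [hB₀])
  -- Normalising the frame by `R` makes its first component the identity, which exhibits the
  -- distribution as the graph of `a₀`.
  let T : (ι → ℝ) × (Fin k → ℝ) → (ι → ℝ) →L[ℝ] (ι → ℝ) × (Fin k → ℝ) :=
    fun w => (B w).comp (R w)
  have hT : ContDiffOn ℝ ∞ T N₁ := (hB.mono hN₁U).clm_comp hR
  let a₀ : (ι → ℝ) × (Fin k → ℝ) → (ι → ℝ) →L[ℝ] (Fin k → ℝ) :=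
    fun w => (ContinuousLinearMap.snd ℝ _ _).comp (T w)
  have ha₀ : ContDiffOn ℝ ∞ a₀ N₁ := contDiffOn_const.clm_comp hT
  have hTa : ∀ w ∈ N₁, ∀ ξ, T w ξ = (ξ, a₀ w ξ) := fun w hw ξ =>
    Prod.ext ((hRB w hw).1 ξ) rfl
  obtain ⟨a, ha, haa₀⟩ := exists_contDiff_eventuallyEq hN₁ ha₀ h0N₁
  have hTd : ∀ w ∈ N₁, ∀ v η, fderiv ℝ T w v η = (0, fderiv ℝ a₀ w v η) := by
    intro w hw v η
    have h1 : HasFDerivAt T (fderiv ℝ T w) w :=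
      ((hT.contDiffAt (hN₁.mem_nhds hw)).differentiableAt (by simp)).hasFDerivAt
    have h2 := hasFDerivAt_clm_comp (ContinuousLinearMap.compL ℝ (ι → ℝ)
      ((ι → ℝ) × (Fin k → ℝ)) (Fin k → ℝ) (ContinuousLinearMap.snd ℝ _ _)) h1
    have h3 := hasFDerivAt_clm_comp (ContinuousLinearMap.compL ℝ (ι → ℝ)
      ((ι → ℝ) × (Fin k → ℝ)) (ι → ℝ) (ContinuousLinearMap.fst ℝ _ _)) h1
    refine Prod.ext ?_ ?_
    · have h4 : (fun y => ContinuousLinearMap.compL ℝ (ι → ℝ) ((ι → ℝ) × (Fin k → ℝ)) (ι → ℝ)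
          (ContinuousLinearMap.fst ℝ _ _) (T y)) =ᶠ[𝓝 w]
          fun _ => ContinuousLinearMap.id ℝ (ι → ℝ) := by
        filter_upwards [hN₁.mem_nhds hw] with y hy
        ext ξ : 1
        exact (hRB y hy).1 ξ
      have h5 := (h3.congr_of_eventuallyEq h4.symm).unique (hasFDerivAt_const _ _)
      exact congrArg (fun L : (ι → ℝ) × (Fin k → ℝ) →L[ℝ] (ι → ℝ) →L[ℝ] (ι → ℝ) => L v η) h5
    · have h4 : fderiv ℝ a₀ w = _ := h2.fderiv
      rw [h4]
      rfl
  have hsym : ∀ w ∈ N₁, ∀ ξ η,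
      fderiv ℝ a₀ w (ξ, a₀ w ξ) η = fderiv ℝ a₀ w (η, a₀ w η) ξ := by
    intro w hw ξ η
    have hwU := hN₁U hw
    -- The product rule term from differentiating `R` stays in the range of `B w`, so it does not
    -- affect membership in the distribution.
    have hTB : ∀ v η, ∃ e, fderiv ℝ T w v η = B w e + fderiv ℝ B w v (R w η) := by
      intro v η
      have h1 : HasFDerivAt B (fderiv ℝ B w) w :=
        ((hB.contDiffAt (hU'.mem_nhds hwU)).differentiableAt (by simp)).hasFDerivAt
      have h2 : HasFDerivAt R (fderiv ℝ R w) w :=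
        ((hR.contDiffAt (hN₁.mem_nhds hw)).differentiableAt (by simp)).hasFDerivAt
      refine ⟨fderiv ℝ R w v η, ?_⟩
      rw [(h1.clm_comp h2).fderiv]
      rfl
    have hΛB : ∀ c, Λ.symm (B w c) = frame Z (pt w) c := fun c => by simp [B]
    obtain ⟨e₁, h₁⟩ := hTB (T w ξ) η
    obtain ⟨e₂, h₂⟩ := hTB (T w η) ξ
    obtain ⟨e₃, h₃⟩ := fderiv_frame_sub_mem
      (fun i => ((hZ i).contDiffAt (hU.mem_nhds hwU)).differentiableAt (by simp))
      ((hfr.contDiffAt (hU.mem_nhds hwU)).differentiableAt (by simp)) (hbr _ hwU)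
      (R w ξ) (R w η)
    have h₄ : fderiv ℝ T w (T w ξ) η - fderiv ℝ T w (T w η) ξ = B w (e₁ - e₂ + e₃) := by
      rw [h₁, h₂, hBd w hwU, hBd w hwU]
      have hξ : Λ.symm (T w ξ) = frame Z (pt w) (R w ξ) := hΛB _
      have hη : Λ.symm (T w η) = frame Z (pt w) (R w η) := hΛB _
      have h₅ : B w e₃ = Λ (frame Z (pt w) e₃) := rfl
      rw [hξ, hη, map_add, map_sub, h₅, ← h₃, map_sub]
      abel
    rw [hTd w hw, hTd w hw] at h₄
    -- The antisymmetrised derivative lies in the distribution, yet its first component is zero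
    -- since that of `T` is constant. A graph meets the vertical direction only in zero.
    have h₅ : e₁ - e₂ + e₃ = 0 := by
      have := (hRB w hw).2 (e₁ - e₂ + e₃)
      rw [← this]
      simp [← h₄]
    rw [h₅, map_zero] at h₄
    have := congrArg Prod.snd h₄
    rw [hTa w hw, hTa w hw] at this
    simpa [sub_eq_zero] using this
  have hnear : ∀ᶠ w in 𝓝 (0 : (ι → ℝ) × (Fin k → ℝ)), w ∈ N₁ ∧ a =ᶠ[𝓝 w] a₀ :=
    Filter.Eventually.and (hN₁.mem_nhds h0N₁) haa₀.eventuallyEq_nhds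
  obtain ⟨N₂, hN₂, hN₂o, h0N₂⟩ := eventually_nhds_iff.1 hnear
  obtain ⟨N₃, hN₃, h0N₃, u, hu, hu₀, huz⟩ := exists_firstIntegral_of_graph ha 0 (by
    filter_upwards [hN₂o.mem_nhds h0N₂] with w hw ξ η
    obtain ⟨hwN, hwa⟩ := hN₂ w hw
    rw [hwa.fderiv_eq, hwa.self_of_nhds]
    exact hsym w hwN ξ η)
  let co : E → (ι → ℝ) × (Fin k → ℝ) := fun z => Λ (z - z₀)
  have hco : ContDiff ℝ ∞ co := Λ.contDiff.comp (contDiff_id.sub contDiff_const)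
  have hco' : ∀ z, HasFDerivAt co (Λ : E →L[ℝ] _) z := fun z =>
    Λ.hasFDerivAt.comp z ((hasFDerivAt_id z).sub_const z₀)
  have hco₀ : co z₀ = 0 := by simp [co]
  have hptco : ∀ z, pt (co z) = z := fun z => by simp [pt, co]
  have hchain : ∀ z, co z ∈ N₃ → ∀ v, fderiv ℝ (u ∘ co) z v = fderiv ℝ u (co z) (Λ v) := by
    intro z hz v
    have h1 : HasFDerivAt u (fderiv ℝ u (co z)) (co z) :=
      ((hu.contDiffAt (hN₃.mem_nhds hz)).differentiableAt (by simp)).hasFDerivAt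
    rw [(h1.comp z (hco' z)).fderiv]
    rfl
  refine ⟨co ⁻¹' (N₂ ∩ N₃), (hN₂o.inter hN₃).preimage hco.continuous, ?_, ?_, u ∘ co,
    hu.comp hco.contDiffOn fun z hz => hz.2, ?_, ?_⟩
  · simp only [Set.mem_preimage, hco₀]
    exact ⟨h0N₂, h0N₃⟩
  · intro z hz
    have := hN₁U (hN₂ _ hz.1).1
    simpa [U', hptco] using this
  · intro z hz i
    obtain ⟨hzN, hza⟩ := hN₂ _ hz.1
    have h1 : Λ (Z i z) = B (co z) (Pi.single i 1) := by
      simp [B, hptco, frame_single]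
    have h2 : B (co z) (Pi.single i 1) =
        T (co z) (B (co z) (Pi.single i 1)).1 := by
      have := (hRB _ hzN).2 (Pi.single i 1)
      simp only [ContinuousLinearMap.comp_apply, ContinuousLinearMap.coe_fst'] at this
      simp only [T, ContinuousLinearMap.comp_apply, this]
    rw [hchain z hz.2, h1, h2, hTa _ hzN, ← hza.self_of_nhds]
    exact huz _ hz.2 _
  · intro v hv
    rw [hchain z₀ (by rw [hco₀]; exact h0N₃), hco₀] at hv
    have hu0 : HasFDerivAt u (fderiv ℝ u 0) 0 :=
      ((hu.contDiffAt (hN₃.mem_nhds h0N₃)).differentiableAt (by simp)).hasFDerivAt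
    -- Since `u` is the identity over the origin and `a 0 = 0`, its derivative at `0` is the second
    -- projection, whose kernel is the straightened span.
    have h1 : ∀ ζ, fderiv ℝ u 0 (0, ζ) = ζ := by
      intro ζ
      have hι := (ContinuousLinearMap.inr ℝ (ι → ℝ) (Fin k → ℝ)).hasFDerivAt (x := 0)
      have hc := HasFDerivAt.comp (0 : Fin k → ℝ) (g := u) (by rw [map_zero]; exact hu0) hι
      have he : (u ∘ ⇑(ContinuousLinearMap.inr ℝ (ι → ℝ) (Fin k → ℝ))) =ᶠ[𝓝 0] id := by
        have hcont : Continuous fun y : Fin k → ℝ => ((0 : ι → ℝ), y) := by fun_prop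
        filter_upwards [(hN₃.preimage hcont).mem_nhds h0N₃] with y hy using hu₀ y hy
      have := (hc.congr_of_eventuallyEq he.symm).unique (hasFDerivAt_id _)
      exact congrArg (fun L : (Fin k → ℝ) →L[ℝ] (Fin k → ℝ) => L ζ) this
    have h2 : ∀ ξ, a 0 ξ = 0 := by
      intro ξ
      rw [haa₀.self_of_nhds]
      simp [a₀, T, hB₀]
    have h3 : fderiv ℝ u 0 (Λ v) = (Λ v).2 := by
      have h4 := huz 0 h0N₃ (Λ v).1
      rw [h2] at h4
      have h5 : Λ v = ((Λ v).1, 0) + (0, (Λ v).2) := by simp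
      conv_lhs => rw [h5, map_add, h4, h1, zero_add]
    rw [h3] at hv
    have h6 : v = frame Z z₀ (Λ v).1 := by
      apply Λ.injective
      rw [hΛ]
      exact Prod.ext rfl hv
    rw [h6, ← range_frame]
    exact ⟨_, rfl⟩

/-! ### Brackets and derivations -/

section Commutation

variable {E : Type*} [NormedAddCommGroup E] [NormedSpace ℝ E]

lemma ContDiffOn.lieBracket_of_isOpen {F X : E → E} {U : Set E} (hU : IsOpen U)
    (hF : ContDiffOn ℝ ∞ F U) (hX : ContDiffOn ℝ ∞ X U) :
    ContDiffOn ℝ ∞ (lieBracket ℝ F X) U := by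
  have h1 := (hX.fderiv_of_isOpen hU (m := ∞) (by simp)).clm_apply hF
  have h2 := (hF.fderiv_of_isOpen hU (m := ∞) (by simp)).clm_apply hX
  exact h1.sub h2

/-- The Lie bracket is the commutator of derivations. -/
lemma fderiv_derivation_comm {G : Type*} [NormedAddCommGroup G] [NormedSpace ℝ G] {g : E → G}
    {F X : E → E} {z : E} (hg : ContDiffAt ℝ ∞ g z) (hF : DifferentiableAt ℝ F z)
    (hX : DifferentiableAt ℝ X z) :
    fderiv ℝ (fun y => fderiv ℝ g y (F y)) z (X z) =
      fderiv ℝ (fun y => fderiv ℝ g y (X y)) z (F z) - fderiv ℝ g z (lieBracket ℝ F X z) := by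
  have h2 : (2 : WithTop ℕ∞) ≤ ∞ := WithTop.coe_le_coe.2 le_top
  have hd : DifferentiableAt ℝ (fderiv ℝ g) z :=
    (hg.fderiv_right (m := 1) (by rwa [one_add_one_eq_two])).differentiableAt (by simp)
  have hs : IsSymmSndFDerivAt ℝ g z := hg.isSymmSndFDerivAt (by
    rwa [minSmoothness_of_isRCLikeNormedField])
  rw [(hd.hasFDerivAt.clm_apply hF.hasFDerivAt).fderiv,
    (hd.hasFDerivAt.clm_apply hX.hasFDerivAt).fderiv]
  simp only [add_apply, ContinuousLinearMap.comp_apply, ContinuousLinearMap.flip_apply,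
    lieBracket, map_sub]
  rw [hs (F z) (X z)]
  abel

lemma lieBracket_prodMk_const {V W : E → E} {p : E × ℝ} (c d : ℝ)
    (hV : DifferentiableAt ℝ V p.1) (hW : DifferentiableAt ℝ W p.1) :
    lieBracket ℝ (fun p : E × ℝ => (V p.1, c)) (fun p : E × ℝ => (W p.1, d)) p =
      (lieBracket ℝ V W p.1, 0) := by
  have h {V : E → E} (c : ℝ) (hV : DifferentiableAt ℝ V p.1) (v : E × ℝ) :
      fderiv ℝ (fun p : E × ℝ => (V p.1, c)) p v = (fderiv ℝ V p.1 v.1, 0) := by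
    have h1 : HasFDerivAt (fun p : E × ℝ => (V p.1, c)) _ p :=
      (hV.hasFDerivAt.comp p hasFDerivAt_fst).prodMk (hasFDerivAt_const c p)
    rw [h1.fderiv]
    rfl
  simp [lieBracket, h _ hV, h _ hW]

end Commutation

/-! ### Coordinates for a prolonged frame and the time function -/

section Prolongation

variable {E : Type} [NormedAddCommGroup E] [NormedSpace ℝ E] {n : ℕ}

/-- The fields `X i` together with their brackets with `F`. -/
noncomputable def prolong (F : E → E) (X : Fin n → E → E) : Fin n ⊕ Fin n → E → E :=
  Sum.elim X fun i => lieBracket ℝ F (X i)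

/-- `X` is an involutive smooth frame on `U` whose prolongation by `F` is again an involutive
frame. -/
structure IsProlongableFrame (F : E → E) (X : Fin n → E → E) (U : Set E) : Prop where
  isOpen : IsOpen U
  contDiffOn_field : ContDiffOn ℝ ∞ F U
  contDiffOn_frame : ∀ i, ContDiffOn ℝ ∞ (X i) U
  linearIndependent : ∀ z ∈ U, LinearIndependent ℝ fun s => prolong F X s z
  involutive_frame : ∀ z ∈ U, ∀ i j,
    lieBracket ℝ (X i) (X j) z ∈ Submodule.span ℝ (Set.range fun i => X i z)
  involutive_prolong : ∀ z ∈ U, ∀ s r,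
    lieBracket ℝ (prolong F X s) (prolong F X r) z ∈
      Submodule.span ℝ (Set.range fun s => prolong F X s z)

variable {F : E → E} {X : Fin n → E → E} {U : Set E}

lemma IsProlongableFrame.contDiffOn_prolong (h : IsProlongableFrame F X U) (s : Fin n ⊕ Fin n) :
    ContDiffOn ℝ ∞ (prolong F X s) U := by
  cases s with
  | inl i => exact h.contDiffOn_frame i
  | inr i => exact h.contDiffOn_field.lieBracket_of_isOpen h.isOpen (h.contDiffOn_frame i)

lemma frame_prolong (z : E) (c : Fin n ⊕ Fin n → ℝ) :
    frame (prolong F X) z c = frame X z (fun i => c (Sum.inl i)) +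
      frame (fun i => lieBracket ℝ F (X i)) z (fun i => c (Sum.inr i)) := by
  simp [frame_apply, prolong]

/-- First integrals of the prolonged frame can be completed to coordinates adapted to the
frame. -/
lemma IsProlongableFrame.exists_chart [FiniteDimensional ℝ E] (h : IsProlongableFrame F X U)
    {k : ℕ} (hk : k + 2 * n = finrank ℝ E) {N₀ : Set E} (hN₀ : IsOpen N₀) (hN₀U : N₀ ⊆ U)
    {z₀ : E} (hz₀ : z₀ ∈ N₀) {t : E → Fin k → ℝ} (ht : ContDiffOn ℝ ∞ t N₀)
    (htk : ∀ v, fderiv ℝ t z₀ v = 0 →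
      v ∈ Submodule.span ℝ (Set.range fun s => prolong F X s z₀)) :
    ∃ ψ : OpenPartialHomeomorph E (TXY k n), z₀ ∈ ψ.source ∧ ψ.source ⊆ N₀ ∧
      ContDiffOn ℝ ∞ ψ ψ.source ∧ ContDiffOn ℝ ∞ ψ.symm ψ.target ∧ ∀ z ∈ ψ.source,
      (∃ e : E ≃L[ℝ] TXY k n, HasFDerivAt ψ (e : E →L[ℝ] TXY k n) z) ∧
      (∀ v, (fderiv ℝ ψ z v).1 = fderiv ℝ t z v) ∧
      (∀ i, (fderiv ℝ ψ z (X i z)).2.1 = 0) ∧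
      (fderiv ℝ ψ z (F z)).2.1 = (ψ z).2.2 := by
  have hz₀U := hN₀U hz₀
  have hindX : LinearIndependent ℝ fun i => X i z₀ :=
    (h.linearIndependent z₀ hz₀U).comp Sum.inl Sum.inl_injective
  obtain ⟨N₁, hN₁, hz₁, hN₁U, u, hu, hu', huk⟩ := exists_firstIntegrals h.isOpen
    h.contDiffOn_frame hz₀U hindX h.involutive_frame (k := k + n)
    (by rw [Fintype.card_fin]; omega)
  let Y : Fin n → E → E := fun i => lieBracket ℝ F (X i)
  let Q : (Fin n → ℝ) →ₗ[ℝ] (Fin (k + n) → ℝ) :=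
    ((fderiv ℝ u z₀).comp (frame Y z₀) : (Fin n → ℝ) →L[ℝ] (Fin (k + n) → ℝ))
  -- The kernel of `fderiv ℝ u z₀` is the span of the `X i`, and no nonzero combination of the
  -- brackets lies in it.
  have hQ : LinearMap.ker Q = ⊥ := by
    rw [LinearMap.ker_eq_bot']
    intro c hc
    have h1 := huk _ hc
    rw [← range_frame] at h1
    obtain ⟨d, hd⟩ := h1
    have h2 : frame (prolong F X) z₀ (Sum.elim (-d) c) = 0 := by
      have hd' : frame X z₀ d = frame Y z₀ c := hd
      rw [frame_prolong]
      simp only [Sum.elim_inl, Sum.elim_inr]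
      change frame X z₀ (-d) + frame Y z₀ c = 0
      rw [map_neg, hd', neg_add_cancel]
    have h3 := frame_injective (h.linearIndependent z₀ hz₀U) (h2.trans (map_zero _).symm)
    ext i
    exact congrFun h3 (Sum.inr i)
  -- The left inverse selects the `n` combinations of first integrals that are dual to the brackets
  -- at `z₀`; they become the `x` coordinates.
  obtain ⟨L, hL⟩ := Q.exists_leftInverse_of_injective hQ
  let Lc : (Fin (k + n) → ℝ) →L[ℝ] (Fin n → ℝ) := L.toContinuousLinearMap
  let x : E → Fin n → ℝ := fun z => Lc (u z)
  have hx : ContDiffOn ℝ ∞ x N₁ := Lc.contDiff.comp_contDiffOn hu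
  have hxd : ∀ z ∈ N₁, ∀ v, fderiv ℝ x z v = Lc (fderiv ℝ u z v) := by
    intro z hz v
    have h1 : HasFDerivAt u (fderiv ℝ u z) z :=
      ((hu.contDiffAt (hN₁.mem_nhds hz)).differentiableAt (by simp)).hasFDerivAt
    have h2 : fderiv ℝ x z = _ := (hasFDerivAt_clm_comp Lc h1).fderiv
    rw [h2]
    rfl
  have hxX : ∀ z ∈ N₁, ∀ i, fderiv ℝ x z (X i z) = 0 := fun z hz i => by
    rw [hxd z hz, hu' z hz, map_zero]
  have hxY : ∀ c, fderiv ℝ x z₀ (frame Y z₀ c) = c := fun c => by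
    rw [hxd z₀ hz₁]
    exact congrArg (fun L : (Fin n → ℝ) →ₗ[ℝ] (Fin n → ℝ) => L c) hL
  -- This choice alone produces the second-order form.
  let y : E → Fin n → ℝ := fun z => fderiv ℝ x z (F z)
  have hy : ContDiffOn ℝ ∞ y N₁ :=
    (hx.fderiv_of_isOpen hN₁ (m := ∞) (by simp)).clm_apply (h.contDiffOn_field.mono hN₁U)
  -- As `x` is constant along `X i` near `z₀`, only the bracket term of the commutator survives.
  have hyX : ∀ c, fderiv ℝ y z₀ (frame X z₀ c) = -c := by
    intro c
    have h1 : ∀ i, fderiv ℝ y z₀ (X i z₀) = - fderiv ℝ x z₀ (Y i z₀) := by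
      intro i
      have h2 := fderiv_derivation_comm (hx.contDiffAt (hN₁.mem_nhds hz₁))
        ((h.contDiffOn_field.contDiffAt (h.isOpen.mem_nhds hz₀U)).differentiableAt (by simp))
        (((h.contDiffOn_frame i).contDiffAt (h.isOpen.mem_nhds hz₀U)).differentiableAt (by simp))
      have h3 : (fun z => fderiv ℝ x z (X i z)) =ᶠ[𝓝 z₀] fun _ => 0 := by
        filter_upwards [hN₁.mem_nhds hz₁] with z hz using hxX z hz i
      rw [h3.fderiv_eq] at h2
      simpa using h2
    calc fderiv ℝ y z₀ (frame X z₀ c) = -fderiv ℝ x z₀ (frame Y z₀ c) := by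
          simp only [frame_apply, map_sum, map_smul, h1, smul_neg, Finset.sum_neg_distrib]
      _ = -c := by rw [hxY]
  let f : E → TXY k n := fun z => (t z, x z, y z)
  have hN : IsOpen (N₀ ∩ N₁) := hN₀.inter hN₁
  have hf : ContDiffOn ℝ ∞ f (N₀ ∩ N₁) := (ht.mono Set.inter_subset_left).prodMk
    ((hx.mono Set.inter_subset_right).prodMk (hy.mono Set.inter_subset_right))
  have hfd : ∀ z ∈ N₀ ∩ N₁, HasFDerivAt f
      ((fderiv ℝ t z).prod ((fderiv ℝ x z).prod (fderiv ℝ y z))) z := by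
    intro z hz
    have hd {G : Type} [NormedAddCommGroup G] [NormedSpace ℝ G] {g : E → G} {S : Set E}
        (hS : IsOpen S) (hg : ContDiffOn ℝ ∞ g S) (hzS : z ∈ S) : HasFDerivAt g (fderiv ℝ g z) z :=
      ((hg.contDiffAt (hS.mem_nhds hzS)).differentiableAt (by simp)).hasFDerivAt
    exact (hd hN₀ ht hz.1).prodMk ((hd hN₁ hx hz.2).prodMk (hd hN₁ hy hz.2))
  let D : E →L[ℝ] TXY k n := (fderiv ℝ t z₀).prod ((fderiv ℝ x z₀).prod (fderiv ℝ y z₀))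
  have hDinj : Function.Injective (D : E →ₗ[ℝ] TXY k n) := by
    rw [injective_iff_map_eq_zero]
    intro v hv
    have hv1 : fderiv ℝ t z₀ v = 0 := congrArg Prod.fst hv
    have hv2 : fderiv ℝ x z₀ v = 0 := congrArg (fun w : TXY k n => w.2.1) hv
    have hv3 : fderiv ℝ y z₀ v = 0 := congrArg (fun w : TXY k n => w.2.2) hv
    have h1 := htk v hv1
    rw [← range_frame] at h1
    obtain ⟨c, rfl⟩ := h1
    change fderiv ℝ x z₀ (frame (prolong F X) z₀ c) = 0 at hv2
    change fderiv ℝ y z₀ (frame (prolong F X) z₀ c) = 0 at hv3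
    change frame (prolong F X) z₀ c = 0
    rw [frame_prolong] at hv2 hv3 ⊢
    have h2 : (fun i => c (Sum.inr i)) = 0 := by
      rw [map_add] at hv2
      have h3 : fderiv ℝ x z₀ (frame X z₀ fun i => c (Sum.inl i)) = 0 := by
        simp only [frame_apply, map_sum, map_smul, hxX z₀ hz₁, smul_zero, Finset.sum_const_zero]
      rw [h3, zero_add] at hv2
      rw [← hxY fun i => c (Sum.inr i)]
      exact hv2
    rw [h2, map_zero, add_zero] at hv3 ⊢
    rw [hyX, neg_eq_zero] at hv3
    rw [hv3, map_zero]
  have hdim : finrank ℝ E = finrank ℝ (TXY k n) := by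
    simp only [Module.finrank_prod, Module.finrank_fintype_fun_eq_card, Fintype.card_fin]
    omega
  let e : E ≃L[ℝ] TXY k n :=
    (LinearMap.linearEquivOfInjective (D : E →ₗ[ℝ] TXY k n) hDinj hdim).toContinuousLinearEquiv
  have he : HasFDerivAt f (e : E →L[ℝ] TXY k n) z₀ := by
    refine (hfd z₀ ⟨hz₀, hz₁⟩).congr_fderiv ?_
    ext v : 1
    rfl
  obtain ⟨ψ, hψ₀, hψN, hψ, hψd, hψs⟩ :=
    exists_openPartialHomeomorph_of_hasFDerivAt hN hf ⟨hz₀, hz₁⟩ he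
  refine ⟨ψ, hψ₀, hψN.trans Set.inter_subset_left, ?_, hψs, fun z hz => ?_⟩
  · rw [hψ]; exact hf.mono hψN
  · have hfz := (hfd z (hψN hz)).fderiv
    rw [hψ, hfz]
    exact ⟨hψd z hz, fun v => rfl, fun i => hxX z (hψN hz).2 i, rfl⟩

/-- The extra coordinate reads off the coefficient of `(F, 1)`; when it is zero only the prolonged
frame contributes. -/
lemma frame_suspension (p : E × ℝ) (c : (Fin n ⊕ Fin n) ⊕ Unit → ℝ) :
    frame (Sum.elim (fun s (p : E × ℝ) => (prolong F X s p.1, (0 : ℝ)))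
      fun _ : Unit => fun p => (F p.1, 1)) p c =
      (frame (prolong F X) p.1 (fun s => c (Sum.inl s)) + c (Sum.inr ()) • F p.1,
        c (Sum.inr ())) := by
  rw [frame_apply, Fintype.sum_sum_type]
  refine Prod.ext ?_ ?_
  · simp only [Sum.elim_inl, Sum.elim_inr, Prod.fst_add, Prod.fst_sum, Prod.smul_fst,
      frame_apply, Finset.univ_unique, Finset.sum_singleton]
  · simp [Prod.snd_sum]

/-- If `F` is transverse to the prolonged frame and preserves it, there are local first integrals
of the prolonged frame, one of which is a time function of `F`. -/
lemma IsProlongableFrame.exists_time [FiniteDimensional ℝ E] (h : IsProlongableFrame F X U)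
    {k : ℕ} (hk : k + 2 * n = finrank ℝ E) {z₀ : E} (hz₀ : z₀ ∈ U)
    (hF : F z₀ ∉ Submodule.span ℝ (Set.range fun s => prolong F X s z₀))
    (hbr : ∀ z ∈ U, ∀ s, lieBracket ℝ F (prolong F X s) z ∈
      Submodule.span ℝ (Set.range fun s => prolong F X s z)) :
    ∃ hk₀ : 0 < k, ∃ N₀ : Set E, IsOpen N₀ ∧ z₀ ∈ N₀ ∧ N₀ ⊆ U ∧ ∃ t : E → Fin k → ℝ,
      ContDiffOn ℝ ∞ t N₀ ∧ (∀ z ∈ N₀, ∀ s, fderiv ℝ t z (prolong F X s z) = 0) ∧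
      (∀ v, fderiv ℝ t z₀ v = 0 →
        v ∈ Submodule.span ℝ (Set.range fun s => prolong F X s z₀)) ∧
      ∀ z ∈ N₀, fderiv ℝ t z (F z) = Pi.single ⟨0, hk₀⟩ 1 := by
  -- Suspending `F` to `(F, 1)` turns the inhomogeneous equation for a time function into a question
  -- about first integrals. One more field in one more dimension leaves their number equal to `k`.
  let Z : (Fin n ⊕ Fin n) ⊕ Unit → E × ℝ → E × ℝ :=
    Sum.elim (fun s (p : E × ℝ) => (prolong F X s p.1, (0 : ℝ))) fun _ : Unit => fun p => (F p.1, 1)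
  have hZf := frame_suspension (F := F) (X := X)
  let U' : Set (E × ℝ) := Prod.fst ⁻¹' U
  have hU' : IsOpen U' := h.isOpen.preimage continuous_fst
  have hZ : ∀ i, ContDiffOn ℝ ∞ (Z i) U' := by
    rintro (s | _)
    · exact ((h.contDiffOn_prolong s).comp contDiff_fst.contDiffOn fun p hp => hp).prodMk
        contDiffOn_const
    · exact (h.contDiffOn_field.comp contDiff_fst.contDiffOn fun p hp => hp).prodMk
        contDiffOn_const
  have hind : LinearIndependent ℝ fun i => Z i (z₀, 0) := by
    rw [Fintype.linearIndependent_iff]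
    intro c hc
    rw [← frame_apply Z, hZf] at hc
    have h1 : c (Sum.inr ()) = 0 := congrArg Prod.snd hc
    have h2 := congrArg Prod.fst hc
    simp only [h1, zero_smul, add_zero, Prod.fst_zero] at h2
    have h3 := frame_injective (h.linearIndependent z₀ hz₀) (h2.trans (map_zero _).symm)
    rintro (s | _)
    · exact congrFun h3 s
    · exact h1
  have hspan : ∀ (p : E × ℝ) (v : E),
      v ∈ Submodule.span ℝ (Set.range fun s => prolong F X s p.1) →
      ((v, 0) : E × ℝ) ∈ Submodule.span ℝ (Set.range fun i => Z i p) := by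
    intro p v hv
    rw [← range_frame] at hv ⊢
    obtain ⟨c, hc⟩ := hv
    refine ⟨Sum.elim c fun _ => 0, ?_⟩
    change frame Z p _ = _
    rw [hZf]
    simp only [Sum.elim_inl, Sum.elim_inr, zero_smul, add_zero]
    exact Prod.ext hc rfl
  have hspan' : ∀ (p : E × ℝ) (v : E),
      ((v, 0) : E × ℝ) ∈ Submodule.span ℝ (Set.range fun i => Z i p) →
      v ∈ Submodule.span ℝ (Set.range fun s => prolong F X s p.1) := by
    intro p v hv
    rw [← range_frame] at hv ⊢
    obtain ⟨c, hc⟩ := hv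
    change frame Z p c = _ at hc
    rw [hZf] at hc
    have h1 : c (Sum.inr ()) = 0 := congrArg Prod.snd hc
    have h2 := congrArg Prod.fst hc
    simp only [h1, zero_smul, add_zero] at h2
    exact ⟨_, h2⟩
  have hZbr : ∀ p ∈ U', ∀ i j,
      lieBracket ℝ (Z i) (Z j) p ∈ Submodule.span ℝ (Set.range fun i => Z i p) := by
    intro p hp i j
    have hdF : DifferentiableAt ℝ F p.1 :=
      (h.contDiffOn_field.contDiffAt (h.isOpen.mem_nhds hp)).differentiableAt (by simp)
    have hdP (s) : DifferentiableAt ℝ (prolong F X s) p.1 :=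
      ((h.contDiffOn_prolong s).contDiffAt (h.isOpen.mem_nhds hp)).differentiableAt (by simp)
    rcases i with s | _ <;> rcases j with r | _
    · simp only [Z, Sum.elim_inl]
      rw [lieBracket_prodMk_const _ _ (hdP s) (hdP r)]
      exact hspan p _ (h.involutive_prolong _ hp s r)
    · simp only [Z, Sum.elim_inl, Sum.elim_inr]
      rw [lieBracket_prodMk_const _ _ (hdP s) hdF, lieBracket_swap]
      exact hspan p _ (Submodule.neg_mem _ (hbr _ hp s))
    · simp only [Z, Sum.elim_inl, Sum.elim_inr]
      rw [lieBracket_prodMk_const _ _ hdF (hdP r)]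
      exact hspan p _ (hbr _ hp r)
    · simp only [Z, Sum.elim_inr]
      rw [lieBracket_prodMk_const _ _ hdF hdF, lieBracket_self]
      exact hspan p _ (Submodule.zero_mem _)
  obtain ⟨N₁, hN₁, hz₁, hN₁U, u, hu, hu', huk⟩ := exists_firstIntegrals hU' hZ
    (z₀ := (z₀, 0)) hz₀ hind hZbr (k := k) (by
      simp only [Fintype.card_sum, Fintype.card_fin, Fintype.card_unit, Module.finrank_prod,
        Module.finrank_self]
      omega)
  have huP : ∀ p ∈ N₁, ∀ s, fderiv ℝ u p (prolong F X s p.1, 0) = 0 :=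
    fun p hp s => hu' p hp (Sum.inl s)
  have huF : ∀ p ∈ N₁, fderiv ℝ u p (F p.1, 1) = 0 := fun p hp => hu' p hp (Sum.inr ())
  have hud : ∀ p ∈ N₁, HasFDerivAt u (fderiv ℝ u p) p := fun p hp =>
    ((hu.contDiffAt (hN₁.mem_nhds hp)).differentiableAt (by simp)).hasFDerivAt
  -- If no first integral depended on the extra variable, then `(F z₀, 0)` would be killed by
  -- `fderiv ℝ u`, which contradicts transversality.
  have hne : fderiv ℝ u (z₀, 0) (0, 1) ≠ 0 := by
    intro h0
    apply hF
    apply hspan' (z₀, 0)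
    apply huk
    have h1 : ((F z₀, 0) : E × ℝ) = (F z₀, 1) - (0, 1) := by simp
    rw [h1, map_sub, h0, huF _ hz₁, sub_zero]
  obtain ⟨j, hj⟩ := Function.ne_iff.1 hne
  have hk₀ : 0 < k := j.pos
  let pr : (Fin k → ℝ) →L[ℝ] ℝ := ContinuousLinearMap.proj j
  let g : E × ℝ → E × ℝ := fun p => (p.1, u p j)
  have hg : ContDiffOn ℝ ∞ g N₁ :=
    contDiff_fst.contDiffOn.prodMk (pr.contDiff.comp_contDiffOn hu)
  have hgd : ∀ p ∈ N₁, HasFDerivAt g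
      ((ContinuousLinearMap.fst ℝ E ℝ).prod (pr.comp (fderiv ℝ u p))) p := fun p hp =>
    hasFDerivAt_fst.prodMk (hasFDerivAt_clm_comp pr (hud p hp))
  let D : E × ℝ →L[ℝ] E × ℝ :=
    (ContinuousLinearMap.fst ℝ E ℝ).prod (pr.comp (fderiv ℝ u (z₀, 0)))
  have hDinj : Function.Injective (D : E × ℝ →ₗ[ℝ] E × ℝ) := by
    rw [injective_iff_map_eq_zero]
    rintro ⟨v, r⟩ hv
    have hv1 : v = 0 := congrArg Prod.fst hv
    have hv2 : fderiv ℝ u (z₀, 0) (v, r) j = 0 := congrArg Prod.snd hv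
    have h1 : ((v, r) : E × ℝ) = r • (0, 1) := by simp [hv1]
    rw [h1, map_smul, Pi.smul_apply, smul_eq_mul] at hv2
    rcases mul_eq_zero.1 hv2 with h2 | h2
    · rw [hv1, h2]; rfl
    · exact absurd h2 hj
  let e : (E × ℝ) ≃L[ℝ] (E × ℝ) :=
    (LinearEquiv.ofInjectiveEndo (D : E × ℝ →ₗ[ℝ] E × ℝ) hDinj).toContinuousLinearEquiv
  have he : HasFDerivAt g (e : E × ℝ →L[ℝ] E × ℝ) (z₀, 0) := by
    refine (hgd _ hz₁).congr_fderiv ?_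
    exact ContinuousLinearMap.ext fun v => rfl
  obtain ⟨φ, hφ₀, hφN, hφ, hφd, hφs⟩ :=
    exists_openPartialHomeomorph_of_hasFDerivAt hN₁ hg hz₁ he
  let w₀ : ℝ := u (z₀, 0) j
  -- The level set of `u_j` through `(z₀, 0)` is the graph of `σ`. Implicit differentiation along
  -- the prolonged frame and along `F` then gives `hσP` and `hσF`.
  let σ : E → ℝ := fun z => (φ.symm (z, w₀)).2
  let N₀ : Set E := (fun z => (z, w₀)) ⁻¹' φ.target
  have hι : ContDiff ℝ ∞ fun z : E => (z, w₀) := contDiff_id.prodMk contDiff_const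
  have hN₀ : IsOpen N₀ := φ.open_target.preimage hι.continuous
  have hσ : ContDiffOn ℝ ∞ σ N₀ :=
    contDiff_snd.comp_contDiffOn (hφs.comp hι.contDiffOn fun z hz => hz)
  have hsymm : ∀ z ∈ N₀, φ.symm (z, w₀) = (z, σ z) ∧ u (z, σ z) j = w₀ := by
    intro z hz
    have h1 := φ.right_inv hz
    rw [hφ] at h1
    have h2 : (φ.symm (z, w₀)).1 = z := congrArg Prod.fst h1
    have h3 : φ.symm (z, w₀) = (z, σ z) := Prod.ext h2 rfl
    refine ⟨h3, ?_⟩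
    rw [← h3]
    exact congrArg Prod.snd h1
  have hmem : ∀ z ∈ N₀, (z, σ z) ∈ φ.source := fun z hz => by
    rw [← (hsymm z hz).1]; exact φ.map_target hz
  have hz₀N : z₀ ∈ N₀ := by
    have := φ.map_source hφ₀
    rwa [hφ] at this
  have hσ₀ : σ z₀ = 0 := by
    have := φ.left_inv hφ₀
    rw [hφ] at this
    exact congrArg Prod.snd this
  have hσd : ∀ z ∈ N₀, HasFDerivAt σ (fderiv ℝ σ z) z := fun z hz =>
    ((hσ.contDiffAt (hN₀.mem_nhds hz)).differentiableAt (by simp)).hasFDerivAt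
  let û : E → Fin k → ℝ := fun z => u (z, σ z)
  have hû : ContDiffOn ℝ ∞ û N₀ :=
    hu.comp (contDiff_id.contDiffOn.prodMk hσ) fun z hz => hφN (hmem z hz)
  have hûd : ∀ z ∈ N₀, HasFDerivAt û ((fderiv ℝ u (z, σ z)).comp
      ((ContinuousLinearMap.id ℝ E).prod (fderiv ℝ σ z))) z := fun z hz =>
    (hud _ (hφN (hmem z hz))).comp z ((hasFDerivAt_id z).prodMk (hσd z hz))
  have hûj : ∀ z ∈ N₀, ∀ v, fderiv ℝ u (z, σ z) (v, fderiv ℝ σ z v) j = 0 := by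
    intro z hz v
    have h1 := hasFDerivAt_clm_comp pr (hûd z hz)
    have h2 : (fun z => pr (û z)) =ᶠ[𝓝 z] fun _ => w₀ := by
      filter_upwards [hN₀.mem_nhds hz] with y hy using (hsymm y hy).2
    have h3 := (h1.congr_of_eventuallyEq h2.symm).unique (hasFDerivAt_const _ _)
    exact congrArg (fun L : E →L[ℝ] ℝ => L v) h3
  have hus : ∀ z ∈ N₀, fderiv ℝ u (z, σ z) (0, 1) j ≠ 0 := by
    intro z hz h0
    obtain ⟨e', he'⟩ := hφd _ (hmem z hz)
    have h1 := he'.unique (hgd _ (hφN (hmem z hz)))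
    have h2 : e' (0, 1) = 0 := by
      have := congrArg (fun L : E × ℝ →L[ℝ] E × ℝ => L (0, 1)) h1
      exact this.trans (Prod.ext rfl h0)
    have h3 := (e'.map_eq_zero_iff).1 h2
    exact one_ne_zero (congrArg Prod.snd h3)
  have hσP : ∀ z ∈ N₀, ∀ s, fderiv ℝ σ z (prolong F X s z) = 0 := by
    intro z hz s
    have h1 := hûj z hz (prolong F X s z)
    have h2 : ((prolong F X s z, fderiv ℝ σ z (prolong F X s z)) : E × ℝ) =
        (prolong F X s z, 0) + fderiv ℝ σ z (prolong F X s z) • (0, 1) := by simp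
    rw [h2, map_add, huP _ (hφN (hmem z hz)) s, zero_add, map_smul, Pi.smul_apply,
      smul_eq_mul] at h1
    exact (mul_eq_zero.1 h1).resolve_right (hus z hz)
  have hσF : ∀ z ∈ N₀, fderiv ℝ σ z (F z) = 1 := by
    intro z hz
    have h1 := hûj z hz (F z)
    have h2 : ((F z, fderiv ℝ σ z (F z)) : E × ℝ) =
        (F z, 1) + (fderiv ℝ σ z (F z) - 1) • (0, 1) := by simp
    rw [h2, map_add, huF _ (hφN (hmem z hz)), zero_add, map_smul, Pi.smul_apply,
      smul_eq_mul] at h1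
    linarith [(mul_eq_zero.1 h1).resolve_right (hus z hz)]
  let j₀ : Fin k := ⟨0, hk₀⟩
  let re : (Fin k → ℝ) →L[ℝ] (Fin k → ℝ) :=
    ContinuousLinearMap.pi fun i => ContinuousLinearMap.proj (Equiv.swap j j₀ i)
  -- The component `û_j` is constant and hence carries no information; its slot is moved to position
  -- `0` and filled with `σ`.
  let t : E → Fin k → ℝ := fun z => re (û z) + σ z • Pi.single j₀ 1
  have htd : ∀ z ∈ N₀, ∀ v, fderiv ℝ t z v =
      re (fderiv ℝ u (z, σ z) (v, fderiv ℝ σ z v)) + fderiv ℝ σ z v • Pi.single j₀ 1 := by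
    intro z hz v
    have h1 : HasFDerivAt t _ z :=
      (hasFDerivAt_clm_comp re (hûd z hz)).add ((hσd z hz).smul_const (Pi.single j₀ 1 : Fin k → ℝ))
    rw [h1.fderiv]
    rfl
  refine ⟨hk₀, N₀, hN₀, hz₀N, fun z hz => hN₁U (hφN (hmem z hz)), t, ?_, ?_, ?_, ?_⟩
  · exact (re.contDiff.comp_contDiffOn hû).add (hσ.smul contDiffOn_const)
  · intro z hz s
    rw [htd z hz, hσP z hz, huP _ (hφN (hmem z hz)) s, map_zero, zero_smul, add_zero]
  · intro v hv
    rw [htd z₀ hz₀N] at hv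
    have h1 : fderiv ℝ σ z₀ v = 0 := by
      have := congrFun hv j₀
      simpa [re, hûj z₀ hz₀N v] using this
    rw [h1, zero_smul, add_zero, hσ₀] at hv
    apply hspan' (z₀, 0)
    apply huk
    ext i
    have := congrFun hv (Equiv.swap j j₀ i)
    simpa [re] using this
  · intro z hz
    rw [htd z hz, hσF z hz, huF _ (hφN (hmem z hz)), map_zero, one_smul, zero_add]

end Prolongation

/-! ### Vector fields in the preferred chart -/

lemma mlieBracket_eq_lieBracket {E : Type*} [NormedAddCommGroup E] [NormedSpace ℝ E]
    {V W : (x : E) → TangentSpace 𝓘(ℝ, E) x} :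
    mlieBracket 𝓘(ℝ, E) V W = lieBracket ℝ V W := by
  rw [← mlieBracketWithin_univ, mlieBracketWithin_eq_lieBracketWithin]
  exact lieBracketWithin_univ

section ChartRepresentation

variable {m : ℕ} {M : Type*} [TopologicalSpace M] [ChartedSpace (EuclideanSpace ℝ (Fin m)) M]

/-- The expression of a vector field in the preferred chart at `z₀`. -/
noncomputable def chartRep (z₀ : M) (X : VectField m M) :
    EuclideanSpace ℝ (Fin m) → EuclideanSpace ℝ (Fin m) :=
  mpullback 𝓘(ℝ, EuclideanSpace ℝ (Fin m)) 𝓘(ℝ, EuclideanSpace ℝ (Fin m))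
    (chartAt (EuclideanSpace ℝ (Fin m)) z₀).symm X

variable [IsManifold 𝓘(ℝ, EuclideanSpace ℝ (Fin m)) ∞ M]

lemma chartAt_mdifferentiable (z₀ : M) :
    (chartAt (EuclideanSpace ℝ (Fin m)) z₀).MDifferentiable 𝓘(ℝ, EuclideanSpace ℝ (Fin m))
      𝓘(ℝ, EuclideanSpace ℝ (Fin m)) :=
  haveI : IsManifold 𝓘(ℝ, EuclideanSpace ℝ (Fin m)) 1 M :=
    IsManifold.of_le (n := ∞) (by simp)
  mdifferentiable_chart z₀

/-- The derivative of the inverse of the preferred chart at `z₀`. -/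
noncomputable def chartEquiv (z₀ : M) {w : EuclideanSpace ℝ (Fin m)}
    (hw : w ∈ (chartAt (EuclideanSpace ℝ (Fin m)) z₀).target) :
    EuclideanSpace ℝ (Fin m) ≃L[ℝ] TangentSpace 𝓘(ℝ, EuclideanSpace ℝ (Fin m))
      ((chartAt (EuclideanSpace ℝ (Fin m)) z₀).symm w) :=
  (chartAt_mdifferentiable z₀).symm.mfderiv hw

lemma chartRep_eq (z₀ : M) (X : VectField m M) {w : EuclideanSpace ℝ (Fin m)}
    (hw : w ∈ (chartAt (EuclideanSpace ℝ (Fin m)) z₀).target) :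
    chartRep z₀ X w =
      (chartEquiv z₀ hw).symm (X ((chartAt (EuclideanSpace ℝ (Fin m)) z₀).symm w)) := by
  have h : mfderiv 𝓘(ℝ, EuclideanSpace ℝ (Fin m)) 𝓘(ℝ, EuclideanSpace ℝ (Fin m))
      (chartAt (EuclideanSpace ℝ (Fin m)) z₀).symm w =
      ((chartAt_mdifferentiable z₀).symm.mfderiv hw : _ →L[ℝ] _) := rfl
  rw [chartRep, mpullback_apply, h, ContinuousLinearMap.inverse_equiv]
  rfl

lemma chartEquiv_chartRep (z₀ : M) (X : VectField m M) {w : EuclideanSpace ℝ (Fin m)}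
    (hw : w ∈ (chartAt (EuclideanSpace ℝ (Fin m)) z₀).target) :
    chartEquiv z₀ hw (chartRep z₀ X w) =
      X ((chartAt (EuclideanSpace ℝ (Fin m)) z₀).symm w) := by
  rw [chartRep_eq z₀ X hw, ContinuousLinearEquiv.apply_symm_apply]

lemma SmoothField.contMDiffAt {X : VectField m M} (hX : SmoothField X) (z : M) :
    ContMDiffAt 𝓘(ℝ, EuclideanSpace ℝ (Fin m)) 𝓘(ℝ, EuclideanSpace ℝ (Fin m)).tangent ∞
      (fun z => (⟨z, X z⟩ : TangentBundle 𝓘(ℝ, EuclideanSpace ℝ (Fin m)) M)) z :=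
  (hX z (Set.mem_univ z)).contMDiffAt Filter.univ_mem

lemma SmoothField.contDiffOn_chartRep {X : VectField m M} (hX : SmoothField X) (z₀ : M) :
    ContDiffOn ℝ ∞ (chartRep z₀ X) (chartAt (EuclideanSpace ℝ (Fin m)) z₀).target := by
  intro w hw
  have hc : ContMDiffAt 𝓘(ℝ, EuclideanSpace ℝ (Fin m)) 𝓘(ℝ, EuclideanSpace ℝ (Fin m)) ∞
      (chartAt (EuclideanSpace ℝ (Fin m)) z₀).symm w :=
    contMDiffOn_chart_symm.contMDiffAt
      ((chartAt (EuclideanSpace ℝ (Fin m)) z₀).open_target.mem_nhds hw)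
  have h := ContMDiffAt.mpullback_vectorField_preimage (hX.contMDiffAt _) hc
    ⟨(chartAt_mdifferentiable z₀).symm.mfderiv hw, rfl⟩ (by simp)
  exact (contMDiffAt_vectorSpace_iff_contDiffAt.1 h).contDiffWithinAt

lemma SmoothField.bracket {X Y : VectField m M} (hX : SmoothField X) (hY : SmoothField Y) :
    SmoothField (bracket X Y) := by
  intro z _
  have hm : minSmoothness ℝ 2 ≤ (∞ : WithTop ℕ∞) := by
    rw [minSmoothness_of_isRCLikeNormedField]
    exact WithTop.coe_le_coe.2 le_top
  have : IsManifold 𝓘(ℝ, EuclideanSpace ℝ (Fin m)) (minSmoothness ℝ 2) M :=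
    IsManifold.of_le (n := ∞) hm
  have : IsManifold 𝓘(ℝ, EuclideanSpace ℝ (Fin m)) (((⊤ : ℕ∞) : WithTop ℕ∞) + 1) M := by
    simpa using (inferInstance : IsManifold 𝓘(ℝ, EuclideanSpace ℝ (Fin m)) ∞ M)
  exact (ContMDiffAt.mlieBracket_vectorField (m := ⊤) (n := ⊤) (hX.contMDiffAt z)
    (hY.contMDiffAt z) (by rw [minSmoothness_of_isRCLikeNormedField]; simp)).contMDiffWithinAt

lemma chartRep_bracket {X Y : VectField m M} (hX : SmoothField X) (hY : SmoothField Y) (z₀ : M)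
    {w : EuclideanSpace ℝ (Fin m)}
    (hw : w ∈ (chartAt (EuclideanSpace ℝ (Fin m)) z₀).target) :
    chartRep z₀ (bracket X Y) w = lieBracket ℝ (chartRep z₀ X) (chartRep z₀ Y) w := by
  have hm : minSmoothness ℝ 2 ≤ (∞ : WithTop ℕ∞) := by
    rw [minSmoothness_of_isRCLikeNormedField]
    exact WithTop.coe_le_coe.2 le_top
  have : IsManifold 𝓘(ℝ, EuclideanSpace ℝ (Fin m)) (minSmoothness ℝ 2) M :=
    IsManifold.of_le (n := ∞) hm
  have hc : ContMDiffAt 𝓘(ℝ, EuclideanSpace ℝ (Fin m)) 𝓘(ℝ, EuclideanSpace ℝ (Fin m)) ∞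
      (chartAt (EuclideanSpace ℝ (Fin m)) z₀).symm w :=
    contMDiffOn_chart_symm.contMDiffAt
      ((chartAt (EuclideanSpace ℝ (Fin m)) z₀).open_target.mem_nhds hw)
  have h := mpullback_mlieBracket (V := X) (W := Y)
    ((hX.contMDiffAt _).mdifferentiableAt (by simp))
    ((hY.contMDiffAt _).mdifferentiableAt (by simp)) hc hm
  exact h.trans (congrFun mlieBracket_eq_lieBracket w)

lemma smoothField_zero : SmoothField (0 : VectField m M) :=
  (Bundle.contMDiff_zeroSection ℝ (TangentSpace 𝓘(ℝ, EuclideanSpace ℝ (Fin m)))).contMDiffOn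

end ChartRepresentation

/-! ### Sections as combinations of a frame -/

section Coefficients

variable {E : Type} [NormedAddCommGroup E] [NormedSpace ℝ E] {n : ℕ}

/-- The bracket of `F` with a section of the distribution spanned by a frame lies in the span of
the prolonged frame. -/
lemma lieBracket_mem_span_prolong [FiniteDimensional ℝ E] {F Y : E → E} {X : Fin n → E → E}
    {U : Set E} (hU : IsOpen U) (hX : ∀ i, ContDiffOn ℝ ∞ (X i) U) {w : E} (hw : w ∈ U)
    (hY : DifferentiableAt ℝ Y w)
    (hind : LinearIndependent ℝ fun i => X i w)
    (hspan : ∀ z ∈ U, Y z ∈ Submodule.span ℝ (Set.range fun i => X i z)) :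
    lieBracket ℝ F Y w ∈ Submodule.span ℝ (Set.range fun s => prolong F X s w) := by
  obtain ⟨Λ, hΛ⟩ := exists_equiv_frame hind (k := finrank ℝ E - Fintype.card (Fin n))
    (Nat.sub_add_cancel hind.fintype_card_le_finrank)
  let P : E →L[ℝ] (Fin n → ℝ) := (ContinuousLinearMap.fst ℝ _ _).comp
    (Λ : E →L[ℝ] (Fin n → ℝ) × (Fin (finrank ℝ E - Fintype.card (Fin n)) → ℝ))
  have hfr := contDiffOn_frame hX
  obtain ⟨N, hN, hwN, hNU, R, hR, hRP⟩ := exists_contDiffOn_inverse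
    (A := fun z => P.comp (frame X z)) hU (contDiffOn_const.clm_comp hfr) hw
    (by ext c : 1; simp [P, hΛ])
  -- The coefficients of `Y` are recovered by a projection that is invertible on the frame near `w`,
  -- which makes them differentiable at `w`.
  have hYeq : ∀ z ∈ N, Y z = frame X z (R z (P (Y z))) := by
    intro z hz
    have h1 := hspan z (hNU hz)
    rw [← range_frame] at h1
    obtain ⟨d, hd⟩ := h1
    have hd' : frame X z d = Y z := hd
    rw [← hd']
    congr 1
    exact ((hRP z hz).2 d).symm
  have hcd : DifferentiableAt ℝ (fun z => R z (P (Y z))) w :=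
    ((hR.contDiffAt (hN.mem_nhds hwN)).differentiableAt (by simp)).clm_apply
      (P.differentiableAt.comp w hY)
  have hfd : DifferentiableAt ℝ (frame X) w :=
    (hfr.contDiffAt (hU.mem_nhds hw)).differentiableAt (by simp)
  have hev : Y =ᶠ[𝓝 w] fun z => frame X z (R z (P (Y z))) := by
    filter_upwards [hN.mem_nhds hwN] with z hz using hYeq z hz
  have hYd := (hfd.hasFDerivAt.clm_apply hcd.hasFDerivAt).congr_of_eventuallyEq hev
  have hXd : ∀ i, DifferentiableAt ℝ (X i) w := fun i =>
    ((hX i).contDiffAt (hU.mem_nhds hw)).differentiableAt (by simp)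
  set c := R w (P (Y w)) with hc
  set d := fderiv ℝ (fun z => R z (P (Y z))) w (F w) with hd
  -- Leibniz rule: the derivatives `d` of the coefficients multiply the `X i`, and the coefficients
  -- `c` multiply the brackets.
  have key : lieBracket ℝ F Y w = frame (prolong F X) w (Sum.elim d c) := by
    rw [frame_prolong]
    simp only [Sum.elim_inl, Sum.elim_inr]
    have h1 : fderiv ℝ Y w (F w) = frame X w d + fderiv ℝ (frame X) w (F w) c := by
      rw [hYd.fderiv]; rfl
    have h2 : fderiv ℝ F w (Y w) = ∑ i, c i • fderiv ℝ F w (X i w) := by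
      rw [hYeq w hwN, frame_apply, map_sum]
      simp only [map_smul, hc]
    rw [lieBracket, h1, h2, fderiv_frame_apply hXd hfd, add_sub_assoc, ← Finset.sum_sub_distrib]
    simp only [← smul_sub]
    rw [frame_apply (fun i => lieBracket ℝ F (X i))]
    rfl
  rw [key, ← range_frame]
  exact ⟨_, rfl⟩

lemma ContinuousLinearEquiv.map_mem_span_range_iff {A B ι : Type*} [AddCommGroup A] [Module ℝ A]
    [TopologicalSpace A] [AddCommGroup B] [Module ℝ B] [TopologicalSpace B] (e : A ≃L[ℝ] B)
    (b : ι → A) (v : A) :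
    e v ∈ Submodule.span ℝ (Set.range fun i => e (b i)) ↔
      v ∈ Submodule.span ℝ (Set.range b) := by
  have h : Submodule.span ℝ (Set.range fun i => e (b i)) =
      (Submodule.span ℝ (Set.range b)).map (e.toLinearEquiv : A →ₗ[ℝ] B) := by
    rw [Submodule.map_span, ← Set.range_comp]
    rfl
  rw [h]
  refine ⟨?_, fun hv => ⟨v, hv, rfl⟩⟩
  rintro ⟨u, hu, huv⟩
  exact e.injective huv ▸ hu

end Coefficients

/-! ### Frames of global sections on the manifold -/

section ManifoldFrame

variable {m n : ℕ} {M : Type*} [TopologicalSpace M] [ChartedSpace (EuclideanSpace ℝ (Fin m)) M]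

/-- The fields `X i` together with their brackets with `F`. -/
noncomputable def prolongField (F : VectField m M) (X : Fin n → VectField m M) :
    Fin n ⊕ Fin n → VectField m M :=
  Sum.elim X fun i => bracket F (X i)

variable [IsManifold 𝓘(ℝ, EuclideanSpace ℝ (Fin m)) ∞ M]

lemma chartRep_mem_span_iff {ι : Type*} (z₀ : M) (b : ι → VectField m M) (Y : VectField m M)
    {w : EuclideanSpace ℝ (Fin m)}
    (hw : w ∈ (chartAt (EuclideanSpace ℝ (Fin m)) z₀).target) :
    chartRep z₀ Y w ∈ Submodule.span ℝ (Set.range fun i => chartRep z₀ (b i) w) ↔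
      Y ((chartAt (EuclideanSpace ℝ (Fin m)) z₀).symm w) ∈
        Submodule.span ℝ (Set.range fun i =>
          b i ((chartAt (EuclideanSpace ℝ (Fin m)) z₀).symm w)) := by
  rw [← (chartEquiv z₀ hw).map_mem_span_range_iff]
  simp only [chartEquiv_chartRep]

lemma linearIndependent_chartRep {ι : Type*} (z₀ : M) {b : ι → VectField m M}
    {w : EuclideanSpace ℝ (Fin m)}
    (hw : w ∈ (chartAt (EuclideanSpace ℝ (Fin m)) z₀).target)
    (h : LinearIndependent ℝ fun i => b i ((chartAt (EuclideanSpace ℝ (Fin m)) z₀).symm w)) :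
    LinearIndependent ℝ fun i => chartRep z₀ (b i) w := by
  have h1 := h.map' (chartEquiv z₀ hw).symm.toLinearEquiv.toLinearMap
    (chartEquiv z₀ hw).symm.toLinearEquiv.ker
  have h2 : (fun i => chartRep z₀ (b i) w) =
      (chartEquiv z₀ hw).symm.toLinearEquiv.toLinearMap ∘
        fun i => b i ((chartAt (EuclideanSpace ℝ (Fin m)) z₀).symm w) :=
    funext fun i => chartRep_eq z₀ (b i) hw
  rw [h2]
  exact h1

lemma SmoothField.prolongField {F : VectField m M} {X : Fin n → VectField m M}
    (hF : SmoothField F) (hX : ∀ i, SmoothField (X i)) (s : Fin n ⊕ Fin n) :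
    SmoothField (prolongField F X s) := by
  cases s with
  | inl i => exact hX i
  | inr i => exact hF.bracket (hX i)

lemma prolong_chartRep {F : VectField m M} {X : Fin n → VectField m M}
    (hF : SmoothField F) (hX : ∀ i, SmoothField (X i)) (z₀ : M) {w : EuclideanSpace ℝ (Fin m)}
    (hw : w ∈ (chartAt (EuclideanSpace ℝ (Fin m)) z₀).target) (s : Fin n ⊕ Fin n) :
    prolong (chartRep z₀ F) (fun i => chartRep z₀ (X i)) s w =
      chartRep z₀ (prolongField F X s) w := by
  cases s with
  | inl i => rfl
  | inr i => exact (chartRep_bracket hF (hX i) z₀ hw).symm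

lemma lieBracket_prolong_chartRep {F Y : VectField m M} {X : Fin n → VectField m M}
    (hF : SmoothField F) (hX : ∀ i, SmoothField (X i)) (hY : SmoothField Y) (z₀ : M)
    {w : EuclideanSpace ℝ (Fin m)}
    (hw : w ∈ (chartAt (EuclideanSpace ℝ (Fin m)) z₀).target) (s : Fin n ⊕ Fin n) :
    lieBracket ℝ (chartRep z₀ Y) (prolong (chartRep z₀ F) (fun i => chartRep z₀ (X i)) s) w =
      chartRep z₀ (bracket Y (prolongField F X s)) w := by
  rw [chartRep_bracket hY (hF.prolongField hX s) z₀ hw]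
  refine Filter.EventuallyEq.lieBracket_vectorField_eq Filter.EventuallyEq.rfl ?_
  filter_upwards [(chartAt (EuclideanSpace ℝ (Fin m)) z₀).open_target.mem_nhds hw] with y hy
  exact prolong_chartRep hF hX z₀ hy s

/-- A distribution is locally spanned by a frame of global sections. -/
lemma IsDistribution.exists_sections [T2Space M] {V : SubspaceField m M}
    (hV : IsDistribution V n) (z₀ : M) :
    ∃ X : Fin n → VectField m M, (∀ i, X i ∈ sectionsOf V) ∧ ∃ Ω : Set M, IsOpen Ω ∧ z₀ ∈ Ω ∧
      ∀ z ∈ Ω, LinearIndependent ℝ (fun i => X i z) ∧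
        Submodule.span ℝ (Set.range fun i => X i z) = V z := by
  obtain ⟨U, hU, hz₀, X, hX, hXV⟩ := hV z₀
  obtain ⟨ρ, -, hρ⟩ := (SmoothBumpFunction.nhds_basis_tsupport
    (I := 𝓘(ℝ, EuclideanSpace ℝ (Fin m))) z₀).mem_iff.1 (hU.mem_nhds hz₀)
  obtain ⟨Ω, hΩ, hΩo, hzΩ⟩ := eventually_nhds_iff.1 (ρ.eventuallyEq_one.and (hU.mem_nhds hz₀))
  -- The cutoff turns local fields into global sections, and `Ω` is taken where `ρ = 1` so that the
  -- frame is unchanged there.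
  refine ⟨fun i => (ρ : M → ℝ) • X i, fun i => ⟨?_, fun z => ?_⟩, Ω, hΩo, hzΩ, fun z hz => ?_⟩
  · exact (ContMDiffOn.smul_section_of_tsupport ρ.contMDiff.contMDiffOn hU hρ (hX i)).contMDiffOn
  · by_cases hz : z ∈ U
    · refine Submodule.smul_mem _ _ ?_
      rw [← (hXV z hz).2]
      exact Submodule.subset_span ⟨i, rfl⟩
    · have h0 : ρ z = 0 := image_eq_zero_of_notMem_tsupport fun h => hz (hρ h)
      change ρ z • X i z ∈ V z
      rw [h0, zero_smul]
      exact Submodule.zero_mem _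
  · have h1 : ρ z = 1 := (hΩ z hz).1
    have h2 : (fun i => ((ρ : M → ℝ) • X i) z) = fun i => X i z := by
      funext i
      change ρ z • X i z = X i z
      rw [h1, one_smul]
    rw [h2]
    exact hXV z (hΩ z hz).2

end ManifoldFrame

/-! ### From the hypotheses on the manifold to the local theory -/

section Setup

variable {m n : ℕ} {M : Type*} [TopologicalSpace M] [ChartedSpace (EuclideanSpace ℝ (Fin m)) M]

lemma bracket_zero_right (F : VectField m M) : bracket F 0 = 0 :=
  mlieBracket_zero_right

variable [IsManifold 𝓘(ℝ, EuclideanSpace ℝ (Fin m)) ∞ M]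

lemma mfderiv_chart_apply (z₀ : M) (Y : VectField m M) {z : M}
    (hz : z ∈ (chartAt (EuclideanSpace ℝ (Fin m)) z₀).source) :
    mfderiv 𝓘(ℝ, EuclideanSpace ℝ (Fin m)) 𝓘(ℝ, EuclideanSpace ℝ (Fin m))
      (chartAt (EuclideanSpace ℝ (Fin m)) z₀) z (Y z) =
      chartRep z₀ Y (chartAt (EuclideanSpace ℝ (Fin m)) z₀ z) := by
  obtain ⟨w, hw, rfl⟩ : ∃ w ∈ (chartAt (EuclideanSpace ℝ (Fin m)) z₀).target,
      (chartAt (EuclideanSpace ℝ (Fin m)) z₀).symm w = z :=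
    ⟨_, OpenPartialHomeomorph.map_source _ hz, OpenPartialHomeomorph.left_inv _ hz⟩
  have h := DFunLike.congr_fun ((chartAt_mdifferentiable z₀).comp_symm_deriv hw)
    (chartRep z₀ Y w)
  rw [OpenPartialHomeomorph.right_inv _ hw]
  rw [← chartEquiv_chartRep z₀ Y hw]
  exact h

/-- A frame of sections of the distribution, in the preferred chart, satisfies the hypotheses of
the local theory. -/
lemma exists_isProlongableFrame [T2Space M] {V : SubspaceField m M} {F : VectField m M}
    {W : Set (VectField m M)} (hF : SmoothField F) (hV : IsDistribution V n)
    (hW : W = plusBracket F (sectionsOf V)) (hdim : ∀ z, finrank ℝ (valuesAt W z) = 2 * n)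
    (hVinv : InvolutiveSystem (sectionsOf V)) (hWinv : InvolutiveSystem W) (z₀ : M) :
    ∃ X : Fin n → VectField m M, (∀ i, SmoothField (X i)) ∧ (∀ s, prolongField F X s ∈ W) ∧
      ∃ U ⊆ (chartAt (EuclideanSpace ℝ (Fin m)) z₀).target,
        chartAt (EuclideanSpace ℝ (Fin m)) z₀ z₀ ∈ U ∧
        IsProlongableFrame (chartRep z₀ F) (fun i => chartRep z₀ (X i)) U ∧
        ∀ w ∈ U, Submodule.span ℝ (Set.range fun i =>
            X i ((chartAt (EuclideanSpace ℝ (Fin m)) z₀).symm w)) =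
            V ((chartAt (EuclideanSpace ℝ (Fin m)) z₀).symm w) ∧
          Submodule.span ℝ (Set.range fun s =>
            prolongField F X s ((chartAt (EuclideanSpace ℝ (Fin m)) z₀).symm w)) =
            valuesAt W ((chartAt (EuclideanSpace ℝ (Fin m)) z₀).symm w) := by
  obtain ⟨X, hX, Ω, hΩ, hzΩ, hXΩ⟩ := hV.exists_sections z₀
  have hXs : ∀ i, SmoothField (X i) := fun i => (hX i).1
  have h0 : (0 : VectField m M) ∈ sectionsOf V := ⟨smoothField_zero, fun z => (V z).zero_mem⟩
  have hPW : ∀ s, prolongField F X s ∈ W := by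
    rw [hW]
    rintro (i | i)
    · exact ⟨X i, hX i, 0, h0, by rw [bracket_zero_right, add_zero]; rfl⟩
    · exact ⟨0, h0, X i, hX i, by rw [zero_add]; rfl⟩
  set c := chartAt (EuclideanSpace ℝ (Fin m)) z₀ with hc
  have hUo : IsOpen (c.target ∩ c.symm ⁻¹' Ω) := c.isOpen_inter_preimage_symm hΩ
  have hFr : ContDiffOn ℝ ∞ (chartRep z₀ F) c.target := hF.contDiffOn_chartRep z₀
  have hXr : ∀ i, ContDiffOn ℝ ∞ (chartRep z₀ (X i)) c.target := fun i =>
    (hXs i).contDiffOn_chartRep z₀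
  have hXU : ∀ i, ContDiffOn ℝ ∞ (chartRep z₀ (X i)) (c.target ∩ c.symm ⁻¹' Ω) := fun i =>
    (hXr i).mono Set.inter_subset_left
  have hspan : ∀ w ∈ c.target ∩ c.symm ⁻¹' Ω, ∀ Y ∈ sectionsOf V,
      chartRep z₀ Y w ∈ Submodule.span ℝ (Set.range fun i => chartRep z₀ (X i) w) := by
    intro w hw Y hY
    refine (chartRep_mem_span_iff z₀ X Y hw.1).2 ?_
    rw [(hXΩ _ hw.2).2]
    exact hY.2 _
  have hindX : ∀ w ∈ c.target ∩ c.symm ⁻¹' Ω,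
      LinearIndependent ℝ fun i => chartRep z₀ (X i) w := fun w hw =>
    linearIndependent_chartRep z₀ hw.1 (hXΩ _ hw.2).1
  have hWspan : ∀ w ∈ c.target ∩ c.symm ⁻¹' Ω, ∀ Y ∈ W,
      Y (c.symm w) ∈ Submodule.span ℝ (Set.range fun s => prolongField F X s (c.symm w)) := by
    intro w hw Y hY
    rw [hW] at hY
    obtain ⟨V₁, h₁, V₂, h₂, rfl⟩ := hY
    refine Submodule.add_mem _ ?_ ?_
    · have : V₁ (c.symm w) ∈ Submodule.span ℝ (Set.range fun i => X i (c.symm w)) := by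
        rw [(hXΩ _ hw.2).2]
        exact h₁.2 _
      refine Submodule.span_mono ?_ this
      rintro _ ⟨i, rfl⟩
      exact ⟨Sum.inl i, rfl⟩
    · rw [← chartRep_mem_span_iff z₀ (prolongField F X) (bracket F V₂) hw.1,
        chartRep_bracket hF h₂.1 z₀ hw.1]
      have h := lieBracket_mem_span_prolong (F := chartRep z₀ F) hUo hXU hw
        (((h₂.1.contDiffOn_chartRep z₀).contDiffAt (c.open_target.mem_nhds hw.1)).differentiableAt
          (by simp)) (hindX w hw) fun y hy => hspan y hy V₂ h₂
      simpa only [prolong_chartRep hF hXs z₀ hw.1] using h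
  have hWeq : ∀ w ∈ c.target ∩ c.symm ⁻¹' Ω,
      Submodule.span ℝ (Set.range fun s => prolongField F X s (c.symm w)) =
        valuesAt W (c.symm w) := by
    intro w hw
    refine le_antisymm (Submodule.span_mono ?_) (Submodule.span_le.2 ?_)
    · rintro _ ⟨s, rfl⟩
      exact ⟨_, hPW s, rfl⟩
    · rintro _ ⟨Y, hY, rfl⟩
      exact hWspan w hw Y hY
  refine ⟨X, hXs, hPW, c.target ∩ c.symm ⁻¹' Ω, Set.inter_subset_left,
    ⟨mem_chart_target _ z₀, ?_⟩, ⟨hUo, hFr.mono Set.inter_subset_left, hXU, ?_, ?_, ?_⟩,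
    fun w hw => ⟨(hXΩ _ hw.2).2, hWeq w hw⟩⟩
  · change c.symm (c z₀) ∈ Ω
    rwa [c.left_inv (mem_chart_source _ z₀)]
  · intro w hw
    simp only [prolong_chartRep hF hXs z₀ hw.1]
    refine linearIndependent_chartRep z₀ hw.1 ?_
    -- The prolonged frame consists of `2 * n` fields and spans the values of `W`, which have
    -- dimension `2 * n`.
    rw [linearIndependent_iff_card_eq_finrank_span, Set.finrank, hWeq w hw, hdim]
    simp [two_mul]
  · intro w hw i j
    rw [← chartRep_bracket (hXs i) (hXs j) z₀ hw.1]
    exact hspan w hw _ (hVinv _ (hX i) _ (hX j))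
  · intro w hw s r
    have hev : prolong (chartRep z₀ F) (fun i => chartRep z₀ (X i)) s =ᶠ[𝓝 w]
        chartRep z₀ (prolongField F X s) := by
      filter_upwards [c.open_target.mem_nhds hw.1] with y hy using prolong_chartRep hF hXs z₀ hy s
    rw [hev.lieBracket_vectorField_eq Filter.EventuallyEq.rfl,
      lieBracket_prolong_chartRep hF hXs (hF.prolongField hXs s) z₀ hw.1]
    simp only [prolong_chartRep hF hXs z₀ hw.1]
    rw [chartRep_mem_span_iff z₀ (prolongField F X) _ hw.1]
    exact hWspan w hw _ (hWinv _ (hPW s) _ (hPW r))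

end Setup

/-! ### Coordinate fields and adapted charts -/

namespace TXY

section ConstField

variable {m k n : ℕ} {M : Type*} [TopologicalSpace M] [ChartedSpace (EuclideanSpace ℝ (Fin m)) M]

lemma constField_eq {φ : OpenPartialHomeomorph M (TXY k n)}
    (hφ : φ.MDifferentiable 𝓘(ℝ, EuclideanSpace ℝ (Fin m)) 𝓘(ℝ, TXY k n)) {z : M}
    (hz : z ∈ φ.source) (v : TXY k n) :
    constField φ v z = (hφ.mfderiv hz).symm v := by
  have h : mfderiv 𝓘(ℝ, EuclideanSpace ℝ (Fin m)) 𝓘(ℝ, TXY k n) φ z =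
      (hφ.mfderiv hz : _ →L[ℝ] _) := rfl
  exact DFunLike.congr_fun ((congrArg ContinuousLinearMap.inverse h).trans
    (ContinuousLinearMap.inverse_equiv _)) v

lemma mfderiv_symm_eq_sum {φ : OpenPartialHomeomorph M (TXY k n)}
    (hφ : φ.MDifferentiable 𝓘(ℝ, EuclideanSpace ℝ (Fin m)) 𝓘(ℝ, TXY k n)) {z : M}
    (hz : z ∈ φ.source) (v : TXY k n) :
    (hφ.mfderiv hz).symm v = ∑ p, v.1 p • dt φ p z + ∑ i, v.2.1 i • dx φ i z +
      ∑ i, v.2.2 i • dy φ i z := by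
  have hv : v = ∑ p, v.1 p • ((Pi.single p 1, 0, 0) : TXY k n) +
      ∑ i, v.2.1 i • ((0, Pi.single i 1, 0) : TXY k n) +
      ∑ i, v.2.2 i • ((0, 0, Pi.single i 1) : TXY k n) := by
    refine Prod.ext ?_ (Prod.ext ?_ ?_) <;>
    · ext j
      simp [Prod.fst_sum, Prod.snd_sum, Finset.sum_apply, Pi.single_apply]
  let L : TXY k n →ₗ[ℝ] TangentSpace 𝓘(ℝ, EuclideanSpace ℝ (Fin m)) z :=
    (hφ.mfderiv hz).symm.toLinearEquiv.toLinearMap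
  have h : L v = ∑ p, v.1 p • L (Pi.single p 1, 0, 0) + ∑ i, v.2.1 i • L (0, Pi.single i 1, 0) +
      ∑ i, v.2.2 i • L (0, 0, Pi.single i 1) := by
    conv_lhs => rw [hv]
    simp only [map_add, map_sum, map_smul]
  simp only [dt, dx, dy, constField_eq hφ hz]
  exact h

end ConstField

end TXY

section AdaptedChart

variable {m k n : ℕ} {M : Type*} [TopologicalSpace M] [ChartedSpace (EuclideanSpace ℝ (Fin m)) M]

namespace TXY

lemma mfderiv_symm_mem_span_dx_dy {φ : OpenPartialHomeomorph M (TXY k n)}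
    (hφ : φ.MDifferentiable 𝓘(ℝ, EuclideanSpace ℝ (Fin m)) 𝓘(ℝ, TXY k n)) {z : M}
    (hz : z ∈ φ.source) {v : TXY k n} (hv : v.1 = 0) :
    (hφ.mfderiv hz).symm v ∈
      Submodule.span ℝ ((Set.range fun i => dx φ i z) ∪ Set.range fun i => dy φ i z) := by
  rw [mfderiv_symm_eq_sum hφ hz v, hv]
  refine Submodule.add_mem _ (Submodule.add_mem _ ?_ ?_) ?_ <;>
    refine Submodule.sum_mem _ fun i _ => ?_
  · exact (zero_smul ℝ (dt (m := m) φ i z)).symm ▸ Submodule.zero_mem _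
  · exact Submodule.smul_mem _ _ (Submodule.subset_span (Or.inl ⟨i, rfl⟩))
  · exact Submodule.smul_mem _ _ (Submodule.subset_span (Or.inr ⟨i, rfl⟩))

lemma mfderiv_symm_mem_span_dy {φ : OpenPartialHomeomorph M (TXY k n)}
    (hφ : φ.MDifferentiable 𝓘(ℝ, EuclideanSpace ℝ (Fin m)) 𝓘(ℝ, TXY k n)) {z : M}
    (hz : z ∈ φ.source) {v : TXY k n} (hv : v.1 = 0) (hv' : v.2.1 = 0) :
    (hφ.mfderiv hz).symm v ∈ Submodule.span ℝ (Set.range fun i => dy φ i z) := by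
  rw [mfderiv_symm_eq_sum hφ hz v, hv, hv']
  refine Submodule.add_mem _ (Submodule.add_mem _ ?_ ?_) ?_ <;>
    refine Submodule.sum_mem _ fun i _ => ?_
  · exact (zero_smul ℝ (dt (m := m) φ i z)).symm ▸ Submodule.zero_mem _
  · exact (zero_smul ℝ (dx (m := m) φ i z)).symm ▸ Submodule.zero_mem _
  · exact Submodule.smul_mem _ _ (Submodule.subset_span ⟨i, rfl⟩)

/-- A chart is adapted as soon as its coordinate fields span bases of `V` and `W`. -/
lemma isAdapted_of_mem_span {φ : OpenPartialHomeomorph M (TXY k n)}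
    {V W : SubspaceField m M} {b : Fin n ⊕ Fin n → VectField m M}
    (hb : ∀ z ∈ φ.source, LinearIndependent ℝ fun s => b s z)
    (hV : ∀ z ∈ φ.source, Submodule.span ℝ (Set.range fun i => b (Sum.inl i) z) = V z)
    (hW : ∀ z ∈ φ.source, Submodule.span ℝ (Set.range fun s => b s z) = W z)
    (hx : ∀ z ∈ φ.source, ∀ i,
      b (Sum.inl i) z ∈ Submodule.span ℝ (Set.range fun i => dy φ i z))
    (ht : ∀ z ∈ φ.source, ∀ s, b s z ∈
      Submodule.span ℝ ((Set.range fun i => dx φ i z) ∪ Set.range fun i => dy φ i z)) :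
    IsAdapted φ V W := by
  intro z hz
  have hfin : FiniteDimensional ℝ (TangentSpace 𝓘(ℝ, EuclideanSpace ℝ (Fin m)) z) :=
    inferInstanceAs (FiniteDimensional ℝ (EuclideanSpace ℝ (Fin m)))
  constructor
  · rw [← hV z hz]
    -- One inclusion suffices: at most `n` dimensions are spanned by the `n` coordinate fields,
    -- while the frame already accounts for `n`. The same count with `2 * n` settles `W`.
    refine Submodule.eq_of_le_of_finrank_le (Submodule.span_le.2 ?_) ?_
    · rintro _ ⟨i, rfl⟩
      exact hx z hz i
    · rw [finrank_span_eq_card (b := fun i => b (Sum.inl i) z)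
        ((hb z hz).comp Sum.inl Sum.inl_injective)]
      exact finrank_range_le_card _
  · have ht' := ht z hz
    rw [← hW z hz]
    rw [← Set.Sum.elim_range] at ht' ⊢
    refine Submodule.eq_of_le_of_finrank_le (Submodule.span_le.2 ?_) ?_
    · rintro _ ⟨s, rfl⟩
      exact ht' s
    · rw [finrank_span_eq_card (hb z hz)]
      exact finrank_range_le_card _

end TXY

variable [IsManifold 𝓘(ℝ, EuclideanSpace ℝ (Fin m)) ∞ M]

/-- Composing the preferred chart with a smooth chart of the model space. -/
lemma isSmoothChart_chartAt_trans (z₀ : M)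
    {ψ : OpenPartialHomeomorph (EuclideanSpace ℝ (Fin m)) (TXY k n)}
    (hψ : ContDiffOn ℝ ∞ ψ ψ.source) (hψ' : ContDiffOn ℝ ∞ ψ.symm ψ.target) :
    TXY.IsSmoothChart m ((chartAt (EuclideanSpace ℝ (Fin m)) z₀).trans ψ) := by
  constructor
  · refine ContMDiffOn.comp (t := ψ.source) hψ.contMDiffOn
      (contMDiffOn_chart.mono fun z hz => hz.1) fun z hz => hz.2
  · refine ContMDiffOn.comp (t := (chartAt (EuclideanSpace ℝ (Fin m)) z₀).target)
      contMDiffOn_chart_symm (hψ'.contMDiffOn.mono fun z hz => hz.1) fun z hz => hz.2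

/-- Coordinates adapted to the prolonged frame, with prescribed coordinates `t` that are constant
along the prolonged frame. -/
lemma exists_adapted_chart {V W : SubspaceField m M} {F : VectField m M}
    {X : Fin n → VectField m M} (hF : SmoothField F) (hX : ∀ i, SmoothField (X i)) {z₀ : M}
    {U : Set (EuclideanSpace ℝ (Fin m))}
    (hU : U ⊆ (chartAt (EuclideanSpace ℝ (Fin m)) z₀).target)
    (h : IsProlongableFrame (chartRep z₀ F) (fun i => chartRep z₀ (X i)) U)
    (hVX : ∀ w ∈ U, Submodule.span ℝ (Set.range fun i =>
      X i ((chartAt (EuclideanSpace ℝ (Fin m)) z₀).symm w)) =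
        V ((chartAt (EuclideanSpace ℝ (Fin m)) z₀).symm w))
    (hWX : ∀ w ∈ U, Submodule.span ℝ (Set.range fun s =>
      prolongField F X s ((chartAt (EuclideanSpace ℝ (Fin m)) z₀).symm w)) =
        W ((chartAt (EuclideanSpace ℝ (Fin m)) z₀).symm w))
    (hk : k + 2 * n = m) {N : Set (EuclideanSpace ℝ (Fin m))} (hN : IsOpen N) (hNU : N ⊆ U)
    (hzN : chartAt (EuclideanSpace ℝ (Fin m)) z₀ z₀ ∈ N)
    {t : EuclideanSpace ℝ (Fin m) → Fin k → ℝ} (ht : ContDiffOn ℝ ∞ t N)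
    (ht0 : ∀ w ∈ N, ∀ s,
      fderiv ℝ t w (prolong (chartRep z₀ F) (fun i => chartRep z₀ (X i)) s w) = 0)
    (htk : ∀ v, fderiv ℝ t (chartAt (EuclideanSpace ℝ (Fin m)) z₀ z₀) v = 0 →
      v ∈ Submodule.span ℝ (Set.range fun s =>
        prolong (chartRep z₀ F) (fun i => chartRep z₀ (X i)) s
          (chartAt (EuclideanSpace ℝ (Fin m)) z₀ z₀))) :
    ∃ φ : OpenPartialHomeomorph M (TXY k n), z₀ ∈ φ.source ∧ TXY.IsSmoothChart m φ ∧
      TXY.IsAdapted φ V W ∧ ∃ f : TXY k n → Fin n → ℝ, ContDiffOn ℝ ∞ f φ.target ∧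
        ∀ z ∈ φ.source, chartAt (EuclideanSpace ℝ (Fin m)) z₀ z ∈ N ∧
          F z = ∑ p, fderiv ℝ t (chartAt (EuclideanSpace ℝ (Fin m)) z₀ z)
              (chartRep z₀ F (chartAt (EuclideanSpace ℝ (Fin m)) z₀ z)) p • TXY.dt φ p z +
            ∑ i, TXY.yCoord φ i z • TXY.dx φ i z + ∑ i, f (φ z) i • TXY.dy φ i z := by
  obtain ⟨ψ, hzψ, hψN, hψ, hψ', hψd⟩ := h.exists_chart (k := k)
    (by rw [finrank_euclideanSpace_fin]; exact hk) hN hNU hzN ht htk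
  set c := chartAt (EuclideanSpace ℝ (Fin m)) z₀ with hc
  have hsm := isSmoothChart_chartAt_trans z₀ hψ hψ'
  rw [← hc] at hsm
  have hφ : (c.trans ψ).MDifferentiable 𝓘(ℝ, EuclideanSpace ℝ (Fin m)) 𝓘(ℝ, TXY k n) :=
    ⟨hsm.1.mdifferentiableOn (by simp), hsm.2.mdifferentiableOn (by simp)⟩
  have hL : ∀ z (hz : z ∈ (c.trans ψ).source) (Y : VectField m M),
      hφ.mfderiv hz (Y z) = fderiv ℝ ψ (c z) (chartRep z₀ Y (c z)) := by
    intro z hz Y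
    have h1 : MDifferentiableAt 𝓘(ℝ, EuclideanSpace ℝ (Fin m)) 𝓘(ℝ, TXY k n) ψ (c z) :=
      ((hψ.contDiffAt (ψ.open_source.mem_nhds hz.2)).differentiableAt
        (by simp)).mdifferentiableAt
    have h2 := mfderiv_comp_apply z h1 ((chartAt_mdifferentiable z₀).mdifferentiableAt hz.1) (Y z)
    refine h2.trans ?_
    rw [mfderiv_eq_fderiv]
    exact congrArg (fderiv ℝ ψ (c z)) (mfderiv_chart_apply z₀ Y hz.1)
  have hmem : ∀ z ∈ (c.trans ψ).source, c z ∈ U := fun z hz => hNU (hψN hz.2)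
  have hinv : ∀ z ∈ (c.trans ψ).source, c.symm (c z) = z := fun z hz => c.left_inv hz.1
  refine ⟨c.trans ψ, ⟨mem_chart_source _ z₀, hzψ⟩, hsm, ?_,
    -- The functions `F^i` are the `y` components of `F` in the chart `ψ`, written as functions of
    -- the coordinate values.
    fun w => (fderiv ℝ ψ (ψ.symm w) (chartRep z₀ F (ψ.symm w))).2.2, ?_,
    fun z hz => ⟨hψN hz.2, ?_⟩⟩
  · have hsymm : ∀ z (hz : z ∈ (c.trans ψ).source) (Y : VectField m M),
        Y z = (hφ.mfderiv hz).symm (fderiv ℝ ψ (c z) (chartRep z₀ Y (c z))) := fun z hz Y => by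
      rw [← hL z hz]
      exact ((hφ.mfderiv hz).symm_apply_apply _).symm
    have ht1 : ∀ z ∈ (c.trans ψ).source, ∀ s,
        (fderiv ℝ ψ (c z) (chartRep z₀ (prolongField F X s) (c z))).1 = 0 := by
      intro z hz s
      refine ((hψd _ hz.2).2.1 _).trans ?_
      rw [← prolong_chartRep hF hX z₀ (hU (hmem z hz))]
      exact ht0 _ (hψN hz.2) s
    refine TXY.isAdapted_of_mem_span (b := prolongField F X) ?_ ?_ ?_ ?_ ?_
    · intro z hz
      have h1 := h.linearIndependent _ (hmem z hz)
      simp only [prolong_chartRep hF hX z₀ (hU (hmem z hz))] at h1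
      have h2 := h1.map' (chartEquiv z₀ (hU (hmem z hz))).toLinearEquiv.toLinearMap
        (chartEquiv z₀ (hU (hmem z hz))).toLinearEquiv.ker
      have h3 : (fun s => prolongField F X s (c.symm (c z))) =
          (chartEquiv z₀ (hU (hmem z hz))).toLinearEquiv.toLinearMap ∘
            fun s => chartRep z₀ (prolongField F X s) (c z) :=
        funext fun s => (chartEquiv_chartRep z₀ _ _).symm
      rw [← h3, hinv z hz] at h2
      exact h2
    · intro z hz
      have := hVX _ (hmem z hz)
      rwa [hinv z hz] at this
    · intro z hz
      have := hWX _ (hmem z hz)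
      rwa [hinv z hz] at this
    · intro z hz i
      rw [hsymm z hz (prolongField F X (Sum.inl i))]
      exact TXY.mfderiv_symm_mem_span_dy hφ hz (ht1 z hz _) ((hψd _ hz.2).2.2.1 i)
    · intro z hz s
      rw [hsymm z hz (prolongField F X s)]
      exact TXY.mfderiv_symm_mem_span_dx_dy hφ hz (ht1 z hz s)
  · have h1 : ContDiffOn ℝ ∞ (fun p => fderiv ℝ ψ p (chartRep z₀ F p)) ψ.source :=
      (hψ.fderiv_of_isOpen ψ.open_source le_rfl).clm_apply
        (h.contDiffOn_field.mono (hψN.trans hNU))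
    exact contDiff_snd.comp_contDiffOn (contDiff_snd.comp_contDiffOn
      (h1.comp (hψ'.mono fun w hw => hw.1) fun w hw => ψ.map_target hw.1))
  · have h1 := TXY.mfderiv_symm_eq_sum hφ hz (hφ.mfderiv hz (F z))
    have h2 : (hφ.mfderiv hz).symm (hφ.mfderiv hz (F z)) = F z :=
      (hφ.mfderiv hz).symm_apply_apply _
    refine h2.symm.trans (h1.trans ?_)
    rw [hL z hz F]
    have ht' : (fderiv ℝ ψ (c z) (chartRep z₀ F (c z))).1 = _ := (hψd _ hz.2).2.1 _
    have hx' : (fderiv ℝ ψ (c z) (chartRep z₀ F (c z))).2.1 = _ := (hψd _ hz.2).2.2.2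
    have hy' : ψ.symm ((c.trans ψ) z) = c z := ψ.left_inv hz.2
    beta_reduce
    rw [hy', ht', hx']
    rfl

end AdaptedChart

end AdaptedCoordinates

/-! ### The two cases -/

theorem theorem1 {m n : ℕ} {M : Type*} [TopologicalSpace M] [T2Space M]
    [ChartedSpace (EuclideanSpace ℝ (Fin m)) M]
    [IsManifold 𝓘(ℝ, EuclideanSpace ℝ (Fin m)) ∞ M]
    (V : SubspaceField m M) (F : VectField m M) (W : Set (VectField m M))
    (hF : SmoothField F)
    (hV : IsDistribution V n)
    (hW : W = plusBracket F (sectionsOf V))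
    (hdim : ∀ z, finrank ℝ (valuesAt W z) = 2 * n)
    (hVinv : InvolutiveSystem (sectionsOf V))
    (hWinv : InvolutiveSystem W) :
    (F ∈ W → {z : M | F z ∈ V z}.Nonempty →
      ∀ z₀ : M, ∃ φ : OpenPartialHomeomorph M (TXY (m - 2 * n) n),
        z₀ ∈ φ.source ∧ TXY.IsSmoothChart m φ ∧ TXY.IsAdapted φ V (valuesAt W) ∧
        ∃ f : TXY (m - 2 * n) n → Fin n → ℝ, ContDiffOn ℝ ∞ f φ.target ∧
          ∀ z ∈ φ.source,
            F z = ∑ i, TXY.yCoord φ i z • TXY.dx φ i z + ∑ i, f (φ z) i • TXY.dy φ i z) ∧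
    ((∀ z, F z ∉ valuesAt W z) → (∀ X ∈ W, bracket F X ∈ W) →
      ∀ z₀ : M, ∃ hm : 0 < m - 2 * n, ∃ φ : OpenPartialHomeomorph M (TXY (m - 2 * n) n),
        z₀ ∈ φ.source ∧ TXY.IsSmoothChart m φ ∧ TXY.IsAdapted φ V (valuesAt W) ∧
        ∃ f : TXY (m - 2 * n) n → Fin n → ℝ, ContDiffOn ℝ ∞ f φ.target ∧
          ∀ z ∈ φ.source,
            F z = TXY.dt φ ⟨0, hm⟩ z + ∑ i, TXY.yCoord φ i z • TXY.dx φ i z +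
              ∑ i, f (φ z) i • TXY.dy φ i z) := by
  -- A subspace of dimension `2 * n` in the tangent space forces `2 * n ≤ m`, so the truncated
  -- subtraction is genuine. A point is needed, since an empty `M` gives no bound.
  have hk : ∀ z₀ : M, m - 2 * n + 2 * n = m := by
    intro z₀
    have h1 : FiniteDimensional ℝ (TangentSpace 𝓘(ℝ, EuclideanSpace ℝ (Fin m)) z₀) :=
      inferInstanceAs (FiniteDimensional ℝ (EuclideanSpace ℝ (Fin m)))
    have h2 := (valuesAt W z₀).finrank_le
    have h3 : finrank ℝ (TangentSpace 𝓘(ℝ, EuclideanSpace ℝ (Fin m)) z₀) = m :=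
      finrank_euclideanSpace_fin
    rw [hdim, h3] at h2
    omega
  have hspan : ∀ {z₀ : M} {X : Fin n → VectField m M} (_ : ∀ i, SmoothField (X i))
      {w : EuclideanSpace ℝ (Fin m)} (hw : w ∈ (chartAt (EuclideanSpace ℝ (Fin m)) z₀).target)
      (_ : Submodule.span ℝ (Set.range fun s =>
        prolongField F X s ((chartAt (EuclideanSpace ℝ (Fin m)) z₀).symm w)) =
          valuesAt W ((chartAt (EuclideanSpace ℝ (Fin m)) z₀).symm w)) (Y : VectField m M),
      chartRep z₀ Y w ∈ Submodule.span ℝ (Set.range fun s =>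
          prolong (chartRep z₀ F) (fun i => chartRep z₀ (X i)) s w) ↔
        Y ((chartAt (EuclideanSpace ℝ (Fin m)) z₀).symm w) ∈
          valuesAt W ((chartAt (EuclideanSpace ℝ (Fin m)) z₀).symm w) := by
    intro z₀ X hX w hw hWw Y
    simp only [prolong_chartRep hF hX z₀ hw]
    rw [chartRep_mem_span_iff z₀ (prolongField F X) Y hw, hWw]
  refine ⟨fun hFW _ z₀ => ?_, fun hFW hFbr z₀ => ?_⟩
  · obtain ⟨X, hX, -, U, hU, hzU, h, hVW⟩ :=
      exists_isProlongableFrame hF hV hW hdim hVinv hWinv z₀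
    obtain ⟨N, hN, hzN, hNU, t, ht, ht0, htk⟩ := exists_firstIntegrals h.isOpen
      h.contDiffOn_prolong hzU (h.linearIndependent _ hzU) h.involutive_prolong (k := m - 2 * n)
      (by rw [finrank_euclideanSpace_fin, Fintype.card_sum, Fintype.card_fin, ← two_mul, hk z₀])
    obtain ⟨φ, hzφ, hφ, hφa, f, hf, hFf⟩ := exists_adapted_chart (V := V) (W := valuesAt W) hF hX hU
      h (fun w hw => (hVW w hw).1) (fun w hw => (hVW w hw).2) (hk z₀) hN hNU hzN ht ht0 htk
    refine ⟨φ, hzφ, hφ, hφa, f, hf, fun z hz => ?_⟩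
    obtain ⟨hzN, hFz⟩ := hFf z hz
    have hFs := (hspan hX (hU (hNU hzN)) (hVW _ (hNU hzN)).2 F).2
      (Submodule.subset_span ⟨F, hFW, rfl⟩)
    -- The `t` coordinates are constant along `W`, so `F ∈ W` removes every `∂/∂t^p` term.
    have hker : ∀ v ∈ Submodule.span ℝ (Set.range fun s =>
        prolong (chartRep z₀ F) (fun i => chartRep z₀ (X i)) s
          (chartAt (EuclideanSpace ℝ (Fin m)) z₀ z)),
        fderiv ℝ t (chartAt (EuclideanSpace ℝ (Fin m)) z₀ z) v = 0 := by
      intro v hv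
      induction hv using Submodule.span_induction with
      | mem v hv => obtain ⟨s, rfl⟩ := hv; exact ht0 _ hzN s
      | zero => exact map_zero _
      | add v w _ _ hv hw => rw [map_add, hv, hw, add_zero]
      | smul a v _ hv => rw [map_smul, hv, smul_zero]
    rw [hker _ hFs] at hFz
    refine hFz.trans ?_
    simp
  · obtain ⟨X, hX, hXW, U, hU, hzU, h, hVW⟩ :=
      exists_isProlongableFrame hF hV hW hdim hVinv hWinv z₀
    obtain ⟨hm, N, hN, hzN, hNU, t, ht, ht0, htk, htF⟩ := h.exists_time (k := m - 2 * n)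
      (by rw [finrank_euclideanSpace_fin, hk z₀]) hzU
      (fun hmem => hFW _ ((hspan hX (hU hzU) (hVW _ hzU).2 F).1 hmem))
      -- Invariance of `W` under `F`, applied to the fields of the prolonged frame, is the missing
      -- bracket condition for the suspension.
      (fun w hw s => by
        rw [lieBracket_prolong_chartRep hF hX hF z₀ (hU hw) s]
        exact (hspan hX (hU hw) (hVW _ hw).2 _).2
          (Submodule.subset_span ⟨_, hFbr _ (hXW s), rfl⟩))
    obtain ⟨φ, hzφ, hφ, hφa, f, hf, hFf⟩ := exists_adapted_chart (V := V) (W := valuesAt W) hF hX hU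
      h (fun w hw => (hVW w hw).1) (fun w hw => (hVW w hw).2) (hk z₀) hN hNU hzN ht ht0 htk
    refine ⟨hm, φ, hzφ, hφ, hφa, f, hf, fun z hz => ?_⟩
    obtain ⟨hzN, hFz⟩ := hFf z hz
    rw [htF _ hzN] at hFz
    refine hFz.trans ?_
    congr 2
    rw [Finset.sum_eq_single ⟨0, hm⟩]
    · simp
    · intro p _ hp
      simp [hp]
    · simp
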